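/- Let $\mathbb{C}\{x,y\}\subset\mathbb{C}[[x,y]]$ denote the rings of convergent and of formal power series, and let $\mathrm{Diff}_{up}(\mathbb{C}^2,0)$ be the set of germs of analytic diffeomorphisms $\varphi$ of $(\mathbb{C}^2,0)$ with $y\circ\varphi=y$ and $j^1\varphi-\mathrm{Id}$ nilpotent. For a formal vector field $X=A\,\partial/\partial x+B\,\partial/\partial y$, singular at the origin and with nilpotent first jet, set $\exp(X)=\bigl(\sum_{j\ge 0}X^j(x)/j!,\ \sum_{j\ge 0}X^j(y)/j!\bigr)$. For $\varphi\in\mathrm{Diff}_{up}(\mathbb{C}^2,0)$ let $\log\varphi$ be the unique such $X$ with $\exp(X)=\varphi$; it is said to converge if $A,B\in\mathbb{C}\{x,y\}$. Let $a,b\ge 1$ be integers, let $f=x^a(x-y)^b$, and let $\mathcal{D}'_f$ be the set of $\varphi\in\mathrm{Diff}_{up}(\mathbb{C}^2,0)$ such that $x\circ\varphi-x\circ\exp(f\,\partial/\partial x)$ belongs to the ideal $(f^2)$ of $\mathbb{C}\{x,y\}$. For $\varphi\in\mathcal{D}'_f$ write $(\log\varphi)(x)=\hat u_{\varphi}f$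 with $\hat u_\varphi$ a unit of $\mathbb{C}[[x,y]]$. Fix $\varphi_0\in\mathcal{D}'_f$. For $\Delta\in\mathbb{C}\{x,y\}$ and $\lambda\in\mathbb{C}$ let $\varphi_{\lambda,\Delta}=(x\circ\varphi_0+\lambda f^2\Delta,\ y)\in\mathcal{D}'_f$, and let $\hat K_\lambda=1/\hat u_{\exp(f\partial/\partial x)}-1/\hat u_{\varphi_{\lambda,\Delta}}$, so that $\partial\alpha/\partial x=\hat K_\lambda/f$ is the homological equation associated to $\exp(f\,\partial/\partial x)$ and $\varphi_{\lambda,\Delta}$. The derived equation is $$\frac{\partial\alpha}{\partial x}=\frac{1}{f}\,\frac{\partial\hat K_\lambda}{\partial\lambda}\Big|_{\lambda=0},$$ where the derivative with respect to $\lambda$ is taken coefficientwise, and the reduced derived equation is $$\frac{\partial\alpha}{\partial x}=\Bigl(\frac{\partial(x\circ\varphi_0)}{\partial x}\Bigr)^{-1}\frac{\Delta}{\hat u_{\varphi_0}^2}.$$ Each of them has solutions $\hat\alpha_\Delta\in\mathbb{C}[[x,y]]$, unique up to adding an element of $\mathbb{C}[[y]]$. Let $S_{a,b,\varphi_0}:\mathbb{C}\{x,y\}\to\mathbb{C}[[y]]$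 be the operator $$S_{a,b,\varphi_0}(\Delta)=\hat\alpha_\Delta(y,y)-\hat\alpha_\Delta(0,y),$$ where $\hat\alpha_\Delta$ is a formal solution of the derived equation. If $S_{a,b,\varphi_0}(\mathbb{C}\{x,y\})\subset\mathbb{C}\{y\}$, then $\log\varphi_0$ converges. The same holds when $S_{a,b,\varphi_0}$ is defined with the reduced derived equation in place of the derived equation. -/

import Mathlib

noncomputable section

namespace UpDiffeo

/-- The ring `ℂ[[x, y]]` of formal power series. The variable `x` has index `0` and the parameter
`y` (also written `x₁`) has index `1`. -/
abbrev Series := MvPowerSeries (Fin 2) ℂ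

/-- The coordinate `x`. -/
abbrev x : Series := MvPowerSeries.X 0

/-- The coordinate `y = x₁`. -/
abbrev y : Series := MvPowerSeries.X 1

/-- A power series in finitely many variables is convergent if it converges absolutely on some
polydisc of positive radius. -/
def IsConvergent {σ : Type} (g : MvPowerSeries σ ℂ) : Prop :=
  ∃ r : ℝ, 0 < r ∧ Summable fun d : σ →₀ ℕ => ‖MvPowerSeries.coeff d g‖ * r ^ d.degree

/-- A formal self-map of `(ℂ², 0)`, given by its components `x ∘ φ` and `y ∘ φ`. -/
abbrev FormalMap := Fin 2 → Series

/-- A formal vector field `A ∂/∂x + B ∂/∂y`, given by its components `A` and `B`. -/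
abbrev FormalField := Fin 2 → Series

/-- The constant terms of the components vanish. -/
def VanishesAtZero (F : Fin 2 → Series) : Prop :=
  ∀ i, MvPowerSeries.constantCoeff (F i) = 0

/-- The matrix of the linear part at the origin. -/
def linearPart (F : Fin 2 → Series) : Matrix (Fin 2) (Fin 2) ℂ :=
  Matrix.of fun i j => MvPowerSeries.coeff (Finsupp.single j 1) (F i)

/-- The class of `F` in `Diff(ℂ², 0)`: a germ of analytic diffeomorphism is identified with its
(convergent) Taylor expansion. -/
def IsDiffeo (φ : FormalMap) : Prop :=
  (∀ i, IsConvergent (φ i)) ∧ VanishesAtZero φ ∧ IsUnit (linearPart φ)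

/-- Unipotent parameterized diffeomorphisms: `y ∘ φ = y` and `j¹φ - Id` is nilpotent. -/
def IsUpDiffeo (φ : FormalMap) : Prop :=
  IsDiffeo φ ∧ φ 1 = y ∧ IsNilpotent (linearPart φ - 1)

/-- Formal nilpotent vector fields: singular at the origin, with nilpotent first jet. -/
def IsNilpotentField (V : FormalField) : Prop :=
  VanishesAtZero V ∧ IsNilpotent (linearPart V)

/-- The action of a vector field on power series as a derivation. -/
def FormalField.apply (V : FormalField) (g : Series) : Series :=
  ∑ i, V i * MvPowerSeries.pderiv ℂ i g

/-- The series `∑ j, V^j(g) / j!`. For a nilpotent vector field `V` the multiplicity of `V^j(g)`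
tends to infinity with `j`, so for each coefficient the sum has only finitely many nonzero terms. -/
def expApply (V : FormalField) (g : Series) : Series :=
  fun d => ∑ᶠ j : ℕ, ((j.factorial : ℂ))⁻¹ * MvPowerSeries.coeff d ((FormalField.apply V)^[j] g)

/-- The exponential `exp(V)` of a formal nilpotent vector field. -/
def fieldExp (V : FormalField) : FormalMap :=
  fun i => expApply V (MvPowerSeries.X i)

/-- `V` is an infinitesimal generator of `φ`. -/
def IsGenerator (φ : FormalMap) (V : FormalField) : Prop :=
  IsNilpotentField V ∧ fieldExp V = φ

/-- The infinitesimal generator `log φ`: the formal nilpotent vector field `V` with `exp(V) = φ`,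
which exists and is unique for every unipotent `φ`. -/
def fieldLog (φ : FormalMap) : FormalField :=
  Classical.epsilon (IsGenerator φ)

/-- A formal vector field converges if its components do. -/
def FormalField.Converges (V : FormalField) : Prop :=
  ∀ i, IsConvergent (V i)

/-- The vector field `f ∂/∂x`. -/
def horizontal (f : Series) : FormalField := ![f, 0]

/-- The set `𝒟'_f` of up-diffeomorphisms `φ` such that `x ∘ φ - x ∘ exp(f ∂/∂x)` belongs to the
ideal `(f²)` of the ring of convergent power series. -/
def DPrime (f : Series) : Set FormalMap :=
  {φ | IsUpDiffeo φ ∧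
    ∃ g : Series, IsConvergent g ∧ φ 0 - fieldExp (horizontal f) 0 = f ^ 2 * g}

/-- The series `û` with `(log φ)(x) = û f`. It exists (and is a unit) for `φ` in `𝒟'_f`. -/
def unitFactor (f : Series) (φ : FormalMap) : Series :=
  Classical.epsilon fun u => FormalField.apply (fieldLog φ) x = u * f

/-- The numerator `K = 1/û₁ - 1/û₂` of the homological equation `∂α/∂x = K/f` associated to `φ₁`
and `φ₂`. -/
def homologicalNumerator (f : Series) (φ₁ φ₂ : FormalMap) : Series :=
  (unitFactor f φ₁)⁻¹ - (unitFactor f φ₂)⁻¹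

/-- The family `φ_{μ,Δ} = (x ∘ φ₀ + μ f² Δ, y)`. -/
def family (f : Series) (φ₀ : FormalMap) (Δ : Series) (μ : ℂ) : FormalMap :=
  ![φ₀ 0 + MvPowerSeries.C μ * f ^ 2 * Δ, y]

/-- `α` is a formal solution of the derived equation `∂α/∂x = (∂K_μ/∂μ)|_{μ=0} / f`, where
`∂α/∂x = K_μ/f` is the homological equation associated to `exp(f ∂/∂x)` and `φ_{μ,Δ}`. The
derivative in `μ` is taken coefficient by coefficient. -/
def IsDerivedSolution (f : Series) (φ₀ : FormalMap) (Δ α : Series) : Prop :=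
  ∀ d : Fin 2 →₀ ℕ, HasDerivAt
    (fun μ : ℂ => MvPowerSeries.coeff d
      (homologicalNumerator f (fieldExp (horizontal f)) (family f φ₀ Δ μ)))
    (MvPowerSeries.coeff d (f * MvPowerSeries.pderiv ℂ 0 α)) 0

/-- `α` is a formal solution of the reduced derived equation
`∂α/∂x = (∂(x ∘ φ₀)/∂x)⁻¹ Δ / û₀²`, where `(log φ₀)(x) = û₀ f`. -/
def IsReducedSolution (f : Series) (φ₀ : FormalMap) (Δ α : Series) : Prop :=
  MvPowerSeries.pderiv ℂ 0 α =
    (MvPowerSeries.pderiv ℂ 0 (φ₀ 0))⁻¹ * (Δ * ((unitFactor f φ₀)⁻¹) ^ 2)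

/-- The series `α(y, y) - α(0, y)` in `ℂ[[y]]`. -/
def transport (α : Series) : PowerSeries ℂ :=
  MvPowerSeries.subst (![PowerSeries.X, PowerSeries.X] : Fin 2 → PowerSeries ℂ) α -
    MvPowerSeries.subst (![0, PowerSeries.X] : Fin 2 → PowerSeries ℂ) α

/-- The function `f = x^a (x - y)^b`. -/
def twoCurves (a b : ℕ) : Series := x ^ a * (x - y) ^ b

/-- The operator `S_{a,b,φ₀}`, sending `Δ` to `α(y, y) - α(0, y)` for a formal solution `α` of the
derived equation. Solutions exist and differ by elements of `ℂ[[y]]`, so that the value does not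
depend on the one that is picked. -/
def derivedOperator (a b : ℕ) (φ₀ : FormalMap) (Δ : Series) : PowerSeries ℂ :=
  transport (Classical.epsilon (IsDerivedSolution (twoCurves a b) φ₀ Δ))

/-- The operator `S_{a,b,φ₀}` computed with the reduced derived equation. -/
def reducedOperator (a b : ℕ) (φ₀ : FormalMap) (Δ : Series) : PowerSeries ℂ :=
  transport (Classical.epsilon (IsReducedSolution (twoCurves a b) φ₀ Δ))

end UpDiffeo

end

/-! Write `x ∘ φ₀ = x + f G` with `G(0) = 1`. Then `log φ₀ = f u ∂/∂x`, where `u` is the fixed point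
of a map contracting the order filtration, and `u` is the unit `û` of the statement.

The derived operator reduces to the reduced one. Put `D = f u ∂/∂x` and let `γ` solve the reduced
equation. If `exp(D)α - α = Dγ`, the field `Y = -αD` satisfies `[Y, D] = D(α) D`. Moving `D` in this
direction therefore changes `exp(D)(x)` by `Y exp(D)x - exp(D)Yx = (exp(D)α - α) D(x ∘ φ₀) = f² Δ`,
which is the variation of the family. Hence `α` solves the derived equation
(`exists_isDerivedSolution`). Moreover `α` can be taken with `α - γ` in the image of `D`, so
divisible by `f`. As `f` vanishes on `x = 0` and on `x = y`, both solutions give the same operator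
(`derivedOperator_eq_reducedOperator`).

The reduced operator is `Δ ↦ ∫_0^y w Δ dx` with `w = (∂(x ∘ φ₀)/∂x)⁻¹ û⁻²`. If it preserves
convergence, Baire's theorem on `ℓ¹` bounds its coefficients exponentially, uniformly over monomials
`Δ` (`exists_uniform_bound`). For `Δ = x^k` these coefficients are the moments `∫_0^1 t^k p(t) dt`
of the homogeneous parts of `w`, regarded as polynomials `p`. Inverting the moment problem costs
only a factor exponential in the degree (`norm_coeff_le_of_moments`), so `w` converges. Finally `û²
· w · ∂(x ∘ φ₀)/∂x = 1` makes `û` an inverse square root of a convergent series, hence convergent.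
-/

noncomputable section

namespace UpDiffeo

open MvPowerSeries
open scoped NNReal ENNReal

/-! ### The order filtration and formal contractions -/

/-- The ideal of power series of order at least `n`. -/
def filt (n : ℕ) : Ideal Series where
  carrier := {g | ∀ d, d.degree < n → coeff d g = 0}
  add_mem' := fun hg hh d hd => by rw [map_add, hg d hd, hh d hd, add_zero]
  zero_mem' := fun d _ => by simp
  smul_mem' := fun c g hg d hd => by
    rw [smul_eq_mul, coeff_mul]
    refine Finset.sum_eq_zero fun p hp => ?_
    rw [Finset.HasAntidiagonal.mem_antidiagonal] at hp
    rw [hg p.2, mul_zero]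
    have := congrArg Finsupp.degree hp
    rw [map_add] at this
    omega

theorem filt_mono {m n : ℕ} (h : m ≤ n) : filt n ≤ filt m :=
  fun _ hg d hd => hg d (hd.trans_le h)

theorem mem_filt_zero (g : Series) : g ∈ filt 0 := fun _ hd => absurd hd (Nat.not_lt_zero _)

theorem mul_mem_filt {m n : ℕ} {g h : Series} (hg : g ∈ filt m) (hh : h ∈ filt n) :
    g * h ∈ filt (m + n) := by
  intro d hd
  rw [coeff_mul]
  refine Finset.sum_eq_zero fun p hp => ?_
  rw [Finset.HasAntidiagonal.mem_antidiagonal] at hp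
  have := congrArg Finsupp.degree hp
  rw [map_add] at this
  by_cases h1 : p.1.degree < m
  · rw [hg _ h1, zero_mul]
  · rw [hh p.2 (by omega), mul_zero]

theorem smul_mem_filt {n : ℕ} {g : Series} (c : ℂ) (hg : g ∈ filt n) : c • g ∈ filt n := by
  rw [smul_eq_C_mul]
  exact Ideal.mul_mem_left _ _ hg

theorem pderiv_mem_filt {n : ℕ} {g : Series} (i : Fin 2) (hg : g ∈ filt (n + 1)) :
    pderiv ℂ i g ∈ filt n := by
  intro d hd
  rw [coeff_pderiv, hg, zero_mul]
  rw [map_add, Finsupp.degree_single]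
  omega

theorem X_mem_filt (i : Fin 2) : (X i : Series) ∈ filt 1 := by
  intro d hd
  have : d = 0 := by rw [← Finsupp.degree_eq_zero_iff]; omega
  rw [this, coeff_zero_X]

theorem mem_filt_one {g : Series} : g ∈ filt 1 ↔ constantCoeff g = 0 := by
  constructor
  · intro h
    rw [← coeff_zero_eq_constantCoeff_apply]
    exact h 0 (by simp)
  · intro h d hd
    have : d = 0 := by rw [← Finsupp.degree_eq_zero_iff]; omega
    rw [this, coeff_zero_eq_constantCoeff_apply, h]

theorem eq_of_sub_mem_filt {g h : Series} (H : ∀ n, g - h ∈ filt n) : g = h := by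
  ext d
  have := H (d.degree + 1) d (Nat.lt_succ_self _)
  rwa [map_sub, sub_eq_zero] at this

theorem eq_of_forall_exists {g h : Series} (s : ℕ → Series) (hg : ∀ n, g - s n ∈ filt n)
    (hh : ∀ n, h - s n ∈ filt n) : g = h :=
  eq_of_sub_mem_filt fun n => by
    simpa using (filt n).sub_mem (hg n) (hh n)

/-- A map contracting the order filtration. -/
def IsContraction (T : Series → Series) : Prop :=
  ∀ n g h, g - h ∈ filt n → T g - T h ∈ filt (n + 1)

theorem IsContraction.exists_fixedPoint {T : Series → Series} (hT : IsContraction T) :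
    ∃ g, T g = g := by
  set s : ℕ → Series := fun k => T^[k] 0 with hs
  have hsucc : ∀ k, s (k + 1) = T (s k) := fun k => Function.iterate_succ_apply' T k 0
  have h1 : ∀ k, s (k + 1) - s k ∈ filt k := by
    intro k
    induction k with
    | zero => exact mem_filt_zero _
    | succ k ih =>
      rw [hsucc (k + 1), hsucc k]
      exact hT _ _ _ (by rwa [hsucc k] at ih)
  have h2 : ∀ k m, k ≤ m → s m - s k ∈ filt k := by
    intro k m hkm
    induction m, hkm using Nat.le_induction with
    | base => simp
    | succ m hm ih =>
      have := (filt k).add_mem (filt_mono hm (h1 m)) ih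
      simpa using this
  let g : Series := fun d => coeff d (s (d.degree + 1))
  have hg : ∀ k, g - s k ∈ filt k := by
    intro k d hd
    rw [map_sub, sub_eq_zero]
    have := h2 (d.degree + 1) k hd d (Nat.lt_succ_self _)
    rw [map_sub, sub_eq_zero] at this
    exact this.symm
  refine ⟨g, eq_of_forall_exists s (fun n => ?_) hg⟩
  cases n with
  | zero => exact mem_filt_zero _
  | succ n =>
    rw [hsucc]
    exact hT _ _ _ (hg n)

/-! ### Power series in a derivation, and the exponential -/

/-- An operator that raises the order of power series by at least `k`. -/
def Raises (k : ℕ) (D : Series → Series) : Prop :=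
  ∀ n g, g ∈ filt n → D g ∈ filt (n + k)

/-- The derivation `g ↦ V(g)` defined by a vector field. -/
def fieldDerivation (V : FormalField) : Derivation ℂ Series Series :=
  ∑ i, V i • pderiv ℂ i

theorem fieldDerivation_apply (V : FormalField) (g : Series) :
    fieldDerivation V g = V 0 * pderiv ℂ 0 g + V 1 * pderiv ℂ 1 g := by
  simp [fieldDerivation, Fin.sum_univ_two]

theorem coe_fieldDerivation (V : FormalField) : ⇑(fieldDerivation V) = V.apply := by
  ext1 g
  rw [fieldDerivation_apply, FormalField.apply, Fin.sum_univ_two]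

theorem fieldDerivation_horizontal (v g : Series) :
    fieldDerivation (horizontal v) g = v * pderiv ℂ 0 g := by
  simp [fieldDerivation_apply, horizontal]

theorem mul_pderiv_mem_filt {k n : ℕ} {v g : Series} (i : Fin 2) (hv : v ∈ filt (k + 1))
    (hg : g ∈ filt n) : v * pderiv ℂ i g ∈ filt (n + k) := by
  cases n with
  | zero =>
    rw [zero_add]
    exact Ideal.mul_mem_right _ _ (filt_mono (Nat.le_succ k) hv)
  | succ n =>
    have := mul_mem_filt hv (pderiv_mem_filt i hg)
    exact filt_mono (by omega) this

theorem raises_fieldDerivation {k : ℕ} {V : FormalField} (hV : ∀ i, V i ∈ filt (k + 1)) :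
    Raises k (fieldDerivation V) := by
  intro n g hg
  rw [fieldDerivation_apply]
  exact (filt _).add_mem (mul_pderiv_mem_filt 0 (hV 0) hg) (mul_pderiv_mem_filt 1 (hV 1) hg)

theorem horizontal_mem_filt {k : ℕ} {v : Series} (hv : v ∈ filt k) (i : Fin 2) :
    horizontal v i ∈ filt k := by
  fin_cases i
  · exact hv
  · exact (filt _).zero_mem

theorem raises_horizontal {k : ℕ} {v : Series} (hv : v ∈ filt (k + 1)) :
    Raises k (fieldDerivation (horizontal v)) :=
  raises_fieldDerivation (horizontal_mem_filt hv)

theorem Raises.iterate {D : Series → Series} (hD : Raises 1 D) {n : ℕ} {g : Series}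
    (hg : g ∈ filt n) (j : ℕ) : D^[j] g ∈ filt (n + j) := by
  induction j with
  | zero => exact hg
  | succ j ih =>
    rw [Function.iterate_succ_apply']
    exact hD _ _ ih

/-- The operator `∑ j, c j • D^j`, for an operator `D` that raises the order. -/
def opSum (c : ℕ → ℂ) (D : Series → Series) (g : Series) : Series :=
  -- `D^j g` has order at least `j`, so later terms do not reach the exponent `d`.
  fun d => ∑ j ∈ Finset.range (d.degree + 1), c j * coeff d (D^[j] g)

theorem coeff_opSum (c : ℕ → ℂ) (D : Series → Series) (g : Series) (d : Fin 2 →₀ ℕ) :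
    coeff d (opSum c D g) = ∑ j ∈ Finset.range (d.degree + 1), c j * coeff d (D^[j] g) :=
  rfl

theorem coeff_opSum_of_le {D : Series → Series} (hD : Raises 1 D) (c : ℕ → ℂ) (g : Series)
    {d : Fin 2 →₀ ℕ} {N : ℕ} (hN : d.degree < N) :
    coeff d (opSum c D g) = ∑ j ∈ Finset.range N, c j * coeff d (D^[j] g) := by
  rw [coeff_opSum]
  refine Finset.sum_subset (Finset.range_subset_range.2 hN) fun j _ hj => ?_
  rw [Finset.mem_range, not_lt] at hj
  rw [hD.iterate (mem_filt_zero g) j d (by omega), mul_zero]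

theorem opSum_sub_mem_filt {D : Series → Series} (hD : Raises 1 D) (c : ℕ → ℂ) (g : Series)
    (N : ℕ) : opSum c D g - ∑ j ∈ Finset.range N, c j • D^[j] g ∈ filt N := by
  intro d hd
  rw [map_sub, coeff_opSum_of_le hD c g hd, map_sum, sub_eq_zero]
  simp

theorem opSum_mem_filt {D : Series → Series} (hD : Raises 1 D) (c : ℕ → ℂ) {g : Series} {n : ℕ}
    (hg : g ∈ filt n) : opSum c D g ∈ filt n := by
  intro d hd
  rw [coeff_opSum]
  refine Finset.sum_eq_zero fun j _ => ?_
  rw [hD.iterate hg j d (by omega), mul_zero]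

theorem opSum_sub (c : ℕ → ℂ) (D : Derivation ℂ Series Series) (g h : Series) :
    opSum c D (g - h) = opSum c D g - opSum c D h := by
  ext d
  simp only [coeff_opSum, map_sub, iterate_map_sub, mul_sub, Finset.sum_sub_distrib]

theorem map_opSum {D : Derivation ℂ Series Series} (hD : Raises 1 D) (c : ℕ → ℂ) (g : Series) :
    D (opSum c D g) = opSum c D (D g) := by
  refine eq_of_forall_exists (fun n => ∑ j ∈ Finset.range n, c j • D^[j] (D g))
    (fun n => ?_) (fun n => opSum_sub_mem_filt hD c (D g) n)
  have h := hD _ _ (opSum_sub_mem_filt hD c g n)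
  rw [map_sub, map_sum] at h
  simp only [Derivation.map_smul, ← Function.iterate_succ_apply'] at h
  simp only [← Function.iterate_succ_apply]
  exact filt_mono (Nat.le_succ n) h

theorem opSum_eq_add {D : Derivation ℂ Series Series} (hD : Raises 1 D) (c : ℕ → ℂ)
    (g : Series) : opSum c D g = c 0 • g + D (opSum (fun j => c (j + 1)) D g) := by
  refine eq_of_forall_exists (fun n => ∑ j ∈ Finset.range (n + 1), c j • D^[j] g)
    (fun n => filt_mono (Nat.le_succ n) (opSum_sub_mem_filt hD c g (n + 1))) (fun n => ?_)
  have h := hD _ _ (opSum_sub_mem_filt hD (fun j => c (j + 1)) g n)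
  rw [map_sub, map_sum] at h
  simp only [Derivation.map_smul, ← Function.iterate_succ_apply'] at h
  rw [Finset.sum_range_succ', add_comm, Function.iterate_zero_apply, add_sub_add_right_eq_sub]
  exact filt_mono (Nat.le_succ n) h

/-- The coefficients `1 / (j + k)!`. -/
def expCoeff (k j : ℕ) : ℂ := (((j + k).factorial : ℕ) : ℂ)⁻¹

theorem expApply_eq_opSum {V : FormalField} (hV : Raises 1 (fieldDerivation V)) (g : Series) :
    expApply V g = opSum (expCoeff 0) (fieldDerivation V) g := by
  ext d
  rw [coeff_opSum]
  change ∑ᶠ j : ℕ, _ = _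
  rw [finsum_eq_sum_of_support_subset (s := Finset.range (d.degree + 1))]
  · rw [coe_fieldDerivation]
    rfl
  · intro j hj
    rw [Finset.coe_range, Set.mem_Iio]
    by_contra hlt
    apply hj
    dsimp only
    rw [← coe_fieldDerivation, hV.iterate (mem_filt_zero g) j d (by omega), mul_zero]

/-- Splitting off the term `j = 0` shifts the factorials by one. Iterating isolates the first terms
of the exponential, with remainders `D E₁` and `D² E₂`, where `E_k = ∑ D^j / (j + k)!`. -/
theorem opSum_expCoeff (k : ℕ) {D : Derivation ℂ Series Series} (hD : Raises 1 D) (g : Series) :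
    opSum (expCoeff k) D g
      = ((k.factorial : ℕ) : ℂ)⁻¹ • g + D (opSum (expCoeff (k + 1)) D g) := by
  rw [opSum_eq_add hD]
  simp only [expCoeff, zero_add]
  congr 4
  ext j
  rw [expCoeff]
  congr 3
  ring

theorem iterate_leibniz (D : Derivation ℂ Series Series) (g h : Series) (n : ℕ) :
    expCoeff 0 n • D^[n] (g * h) = ∑ p ∈ Finset.HasAntidiagonal.antidiagonal n,
      (expCoeff 0 p.1 • D^[p.1] g) * (expCoeff 0 p.2 • D^[p.2] h) := by
  have hstep : ∀ (j : ℕ) (k : Series),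
      D (expCoeff 0 j • D^[j] k) = ((j + 1 : ℕ) : ℂ) • (expCoeff 0 (j + 1) • D^[j + 1] k) := by
    intro j k
    rw [Derivation.map_smul, Function.iterate_succ_apply', smul_smul]
    congr 1
    have : ((j + 1 : ℕ) : ℂ) ≠ 0 := Nat.cast_ne_zero.2 (Nat.succ_ne_zero j)
    simp only [expCoeff, add_zero, Nat.factorial_succ, Nat.cast_mul]
    field_simp
  induction n with
  | zero => simp [expCoeff]
  | succ n ih =>
    have hn : ((n + 1 : ℕ) : ℂ) ≠ 0 := Nat.cast_ne_zero.2 (Nat.succ_ne_zero n)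
    refine smul_right_injective Series hn ?_
    dsimp only
    rw [← hstep, ih, map_sum]
    simp only [Derivation.leibniz, hstep, Finset.sum_add_distrib]
    rw [Finset.smul_sum]
    have e : ∀ p ∈ Finset.HasAntidiagonal.antidiagonal (n + 1),
        ((n + 1 : ℕ) : ℂ) • ((expCoeff 0 p.1 • D^[p.1] g) * (expCoeff 0 p.2 • D^[p.2] h))
        = (expCoeff 0 p.1 • D^[p.1] g) • ((p.2 : ℂ) • (expCoeff 0 p.2 • D^[p.2] h))
        + (expCoeff 0 p.2 • D^[p.2] h) • ((p.1 : ℂ) • (expCoeff 0 p.1 • D^[p.1] g)) := by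
      intro p hp
      rw [Finset.HasAntidiagonal.mem_antidiagonal] at hp
      rw [← hp, Nat.cast_add, add_comm (p.1 : ℂ), add_smul]
      simp only [smul_eq_C_mul, smul_eq_mul]
      ring
    rw [Finset.sum_congr rfl e, Finset.sum_add_distrib, Finset.Nat.sum_antidiagonal_succ',
      Finset.Nat.sum_antidiagonal_succ]
    simp

/-- By Leibniz for the divided powers `D^n / n!`, both sides are Cauchy products. Up to order `n`,
the triangle `i + j < n` and the square `i, j < n` give the same partial sum. -/
theorem opSum_exp_mul {D : Derivation ℂ Series Series} (hD : Raises 1 D) (g h : Series) :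
    opSum (expCoeff 0) D (g * h) = opSum (expCoeff 0) D g * opSum (expCoeff 0) D h := by
  set A : ℕ → Series := fun j => expCoeff 0 j • D^[j] g with hA
  set B : ℕ → Series := fun j => expCoeff 0 j • D^[j] h with hB
  have hAm : ∀ j, A j ∈ filt j := fun j =>
    smul_mem_filt _ (by simpa using hD.iterate (mem_filt_zero g) j)
  have hBm : ∀ j, B j ∈ filt j := fun j =>
    smul_mem_filt _ (by simpa using hD.iterate (mem_filt_zero h) j)
  refine eq_of_forall_exists
    (fun n => (∑ i ∈ Finset.range n, A i) * ∑ j ∈ Finset.range n, B j) (fun n => ?_) (fun n => ?_)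
  · have h1 := opSum_sub_mem_filt hD (expCoeff 0) (g * h) n
    simp only [iterate_leibniz] at h1
    change _ - ∑ k ∈ Finset.range n, ∑ p ∈ Finset.HasAntidiagonal.antidiagonal k, A p.1 * B p.2
      ∈ filt n at h1
    have h2 : (∑ i ∈ Finset.range n, A i) * (∑ j ∈ Finset.range n, B j)
        - ∑ k ∈ Finset.range n, ∑ p ∈ Finset.HasAntidiagonal.antidiagonal k, A p.1 * B p.2
          ∈ filt n := by
      rw [Finset.sum_mul_sum, ← Finset.sum_product',
        ← Finset.sum_filter_add_sum_filter_not _ (fun p : ℕ × ℕ => p.1 + p.2 < n)]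
      have e : ∑ p ∈ (Finset.range n ×ˢ Finset.range n).filter (fun p => p.1 + p.2 < n),
          A p.1 * B p.2
          = ∑ k ∈ Finset.range n, ∑ p ∈ Finset.HasAntidiagonal.antidiagonal k, A p.1 * B p.2 := by
        rw [← Finset.sum_fiberwise_of_maps_to (g := fun p : ℕ × ℕ => p.1 + p.2)
          (t := Finset.range n)]
        · refine Finset.sum_congr rfl fun k hk => Finset.sum_congr ?_ fun _ _ => rfl
          ext p
          simp only [Finset.mem_filter, Finset.mem_product, Finset.mem_range,
            Finset.HasAntidiagonal.mem_antidiagonal] at hk ⊢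
          omega
        · intro p hp
          rw [Finset.mem_filter] at hp
          exact Finset.mem_range.2 hp.2
      rw [e, add_sub_cancel_left]
      refine (filt n).sum_mem fun p hp => ?_
      rw [Finset.mem_filter] at hp
      exact filt_mono (not_lt.1 hp.2) (mul_mem_filt (hAm _) (hBm _))
    have := (filt n).sub_mem h1 h2
    rwa [sub_sub_sub_cancel_right] at this
  · have hg := opSum_sub_mem_filt hD (expCoeff 0) g n
    have hh := opSum_sub_mem_filt hD (expCoeff 0) h n
    have e : opSum (expCoeff 0) D g * opSum (expCoeff 0) D h
        - (∑ i ∈ Finset.range n, A i) * ∑ j ∈ Finset.range n, B j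
        = (opSum (expCoeff 0) D g - ∑ i ∈ Finset.range n, A i) * opSum (expCoeff 0) D h
          + (∑ i ∈ Finset.range n, A i)
            * (opSum (expCoeff 0) D h - ∑ j ∈ Finset.range n, B j) := by ring
    rw [e]
    exact (filt n).add_mem ((filt n).mul_mem_right _ hg) ((filt n).mul_mem_left _ hh)

/-- Induction on the power, from `D^(j+1) - D'^(j+1) = D (D^j - D'^j) + (D - D') D'^j`. -/
theorem opSum_sub_opSum_mem_filt {D D' : Derivation ℂ Series Series} (hD : Raises 1 D)
    (hD' : Raises 1 D') {n : ℕ} (hsub : Raises (n + 1) (D - D')) (c : ℕ → ℂ) {k : ℕ} {g : Series}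
    (hg : g ∈ filt k) : opSum c D g - opSum c D' g ∈ filt (k + (n + 1)) := by
  have key : ∀ j, D^[j] g - D'^[j] g ∈ filt (k + (n + 1)) := by
    intro j
    induction j with
    | zero => simp
    | succ j ih =>
      rw [Function.iterate_succ_apply', Function.iterate_succ_apply']
      have e : D (D^[j] g) - D' (D'^[j] g)
          = D (D^[j] g - D'^[j] g) + (D - D') (D'^[j] g) := by
        simp
      rw [e]
      exact (filt _).add_mem (filt_mono (Nat.le_succ _) (hD _ _ ih))
        (filt_mono (by omega) (hsub _ _ (hD'.iterate hg j)))
  intro d hd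
  rw [map_sub, coeff_opSum, coeff_opSum, ← Finset.sum_sub_distrib]
  refine Finset.sum_eq_zero fun j _ => ?_
  rw [← mul_sub, ← map_sub, key j d hd, mul_zero]

/-! ### Linear parts and uniqueness of the infinitesimal generator -/

theorem coeff_single_eq (j : Fin 2) (g : Series) :
    coeff (Finsupp.single j 1) g = constantCoeff (pderiv ℂ j g) := by
  rw [← coeff_zero_eq_constantCoeff_apply, coeff_pderiv]
  simp

theorem linearPart_apply (F : Fin 2 → Series) (i j : Fin 2) :
    linearPart F i j = constantCoeff (pderiv ℂ j (F i)) := by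
  rw [linearPart, Matrix.of_apply, coeff_single_eq]

theorem mem_filt_two {g : Series} :
    g ∈ filt 2 ↔ constantCoeff g = 0 ∧ ∀ j, constantCoeff (pderiv ℂ j g) = 0 := by
  constructor
  · intro h
    exact ⟨mem_filt_one.1 (filt_mono (by norm_num) h), fun j => mem_filt_one.1 (pderiv_mem_filt j h)⟩
  · rintro ⟨h0, h1⟩ d hd
    by_cases hd0 : d.degree = 0
    · rw [Finsupp.degree_eq_zero_iff] at hd0
      rw [hd0, coeff_zero_eq_constantCoeff_apply, h0]
    · have : d.degree = 1 := by omega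
      obtain ⟨j, rfl⟩ : ∃ j, d = Finsupp.single j 1 := by
        rw [Finsupp.degree_eq_sum, Fin.sum_univ_two] at this
        rcases Nat.eq_zero_or_pos (d 0) with h | h
        · exact ⟨1, by ext i; fin_cases i <;> simp <;> omega⟩
        · exact ⟨0, by ext i; fin_cases i <;> simp <;> omega⟩
      rw [coeff_single_eq, h1]

theorem constantCoeff_pderiv_apply {V : FormalField} (hV : VanishesAtZero V) (j : Fin 2)
    (g : Series) : constantCoeff (pderiv ℂ j (V.apply g))
      = ∑ i, constantCoeff (pderiv ℂ i g) * linearPart V i j := by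
  simp only [FormalField.apply, Fin.sum_univ_two, map_add, Derivation.leibniz, smul_eq_mul,
    map_mul, hV 0, hV 1, linearPart_apply]
  ring

theorem constantCoeff_pderiv_iterate {V : FormalField} (hV : VanishesAtZero V) (i j : Fin 2)
    (k : ℕ) : constantCoeff (pderiv ℂ j (V.apply^[k] (X i))) = (linearPart V ^ k) i j := by
  induction k generalizing j with
  | zero =>
    rw [Function.iterate_zero_apply, pderiv_X, pow_zero, Matrix.one_apply]
    by_cases h : i = j
    · simp [h]
    · simp [h]
  | succ k ih =>
    rw [Function.iterate_succ_apply', constantCoeff_pderiv_apply hV, pow_succ, Matrix.mul_apply]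
    simp only [ih]

theorem sq_eq_zero_of_isNilpotent {N : Matrix (Fin 2) (Fin 2) ℂ} (hN : IsNilpotent N) :
    N ^ 2 = 0 := by
  have ht : N.trace = 0 := (Matrix.isNilpotent_trace_of_isNilpotent hN).eq_zero
  have hd : N.det = 0 := by
    obtain ⟨k, hk⟩ := hN
    exact IsNilpotent.eq_zero ⟨k, by rw [← Matrix.det_pow, hk, Matrix.det_zero]⟩
  rw [Matrix.trace_fin_two] at ht
  rw [Matrix.det_fin_two] at hd
  ext i j
  rw [sq, Matrix.mul_apply, Fin.sum_univ_two]
  fin_cases i <;> fin_cases j <;> simp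
  · linear_combination N 0 0 * ht - hd
  · linear_combination N 0 1 * ht
  · linear_combination N 1 0 * ht
  · linear_combination N 1 1 * ht - hd

/-- The generator selected by `fieldLog` is only known to have a nilpotent linear part `N`. Since
`N² = 0`, the linear part of `exp(V)` is `1 + N`; it is the identity, so `N = 0`. -/
theorem IsGenerator.mem_filt_two {φ : FormalMap} {V : FormalField} (h : IsGenerator φ V)
    (hφ : ∀ i, φ i - X i ∈ filt 2) (i : Fin 2) : V i ∈ filt 2 := by
  obtain ⟨⟨hV, hN⟩, hexp⟩ := h
  have hsq := sq_eq_zero_of_isNilpotent hN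
  have hzero : ∀ i j, linearPart V i j = 0 := by
    intro i j
    have h1 := (UpDiffeo.mem_filt_two.1 (hφ i)).2 j
    rw [map_sub, map_sub, sub_eq_zero, ← coeff_single_eq, ← hexp] at h1
    change ∑ᶠ k : ℕ, _ = _ at h1
    rw [finsum_eq_sum_of_support_subset (s := Finset.range 2)] at h1
    · simp only [coeff_single_eq, constantCoeff_pderiv_iterate hV, Finset.sum_range_succ] at h1
      have h2 := constantCoeff_pderiv_iterate hV i j 0
      rw [Function.iterate_zero_apply] at h2
      rw [h2] at h1
      simpa using h1
    · intro k hk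
      rw [Finset.coe_range, Set.mem_Iio]
      by_contra hlt
      apply hk
      dsimp only
      rw [coeff_single_eq, constantCoeff_pderiv_iterate hV, pow_eq_zero_of_le (not_lt.1 hlt) hsq]
      simp
  refine UpDiffeo.mem_filt_two.2 ⟨hV i, fun j => ?_⟩
  rw [← linearPart_apply, hzero]

theorem fieldExp_apply {V : FormalField} (hV : ∀ i, V i ∈ filt 2) (i : Fin 2) :
    fieldExp V i = opSum (expCoeff 0) (fieldDerivation V) (X i) :=
  expApply_eq_opSum (raises_fieldDerivation hV) _

theorem fieldDerivation_X (V : FormalField) (i : Fin 2) : fieldDerivation V (X i) = V i := by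
  rw [fieldDerivation_apply]
  fin_cases i <;> simp

theorem opSum_expCoeff_zero {D : Derivation ℂ Series Series} (hD : Raises 1 D) (g : Series) :
    opSum (expCoeff 0) D g = g + D g + D (D (opSum (expCoeff 2) D g)) := by
  rw [opSum_expCoeff 0 hD, opSum_expCoeff 1 hD, map_add]
  simp [add_assoc]

theorem sub_fieldDerivation (V W : FormalField) :
    ⇑(fieldDerivation V) - ⇑(fieldDerivation W) = fieldDerivation (V - W) := by
  ext1 g
  simp only [Pi.sub_apply, fieldDerivation_apply]
  ring

theorem raises_sub_mem_filt {D D' : Derivation ℂ Series Series} (hD : Raises 1 D) {n k : ℕ}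
    (hsub : Raises (n + 1) (D - D')) {g g' : Series} (h : g - g' ∈ filt (k + n))
    (hg' : g' ∈ filt k) : D g - D' g' ∈ filt (k + 1 + n) := by
  have e : D g - D' g' = D (g - g') + (D - D') g' := by simp
  rw [e]
  exact (filt _).add_mem (filt_mono (by omega) (hD _ _ h)) (filt_mono (by omega) (hsub _ _ hg'))

/-- The exponential determines a vector field of order at least two. -/
theorem eq_of_fieldExp_eq {V W : FormalField} (hV : ∀ i, V i ∈ filt 2) (hW : ∀ i, W i ∈ filt 2)
    (h : fieldExp V = fieldExp W) : V = W := by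
  have hDV := raises_fieldDerivation hV
  have hDW := raises_fieldDerivation hW
  have key : ∀ n i, V i - W i ∈ filt (n + 2) := by
    intro n
    induction n with
    | zero => exact fun i => (filt 2).sub_mem (hV i) (hW i)
    | succ n ih =>
      intro i
      have hsub : Raises (n + 1) (⇑(fieldDerivation V) - ⇑(fieldDerivation W)) := by
        rw [sub_fieldDerivation]
        exact raises_fieldDerivation ih
      have h1 := opSum_sub_opSum_mem_filt hDV hDW hsub (expCoeff 2) (X_mem_filt i)
      have h2 := opSum_mem_filt hDW (expCoeff 2) (X_mem_filt i)
      have h3 := raises_sub_mem_filt hDV hsub (filt_mono (by omega) h1) h2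
      have h4 := raises_sub_mem_filt hDV hsub h3 (hDW _ _ h2)
      have h5 := congrFun h i
      rw [fieldExp_apply hV, fieldExp_apply hW, opSum_expCoeff_zero hDV, opSum_expCoeff_zero hDW,
        fieldDerivation_X, fieldDerivation_X] at h5
      -- Equal exponentials make the difference of the fields equal to minus the difference of the
      -- remainders `D² E₂ x_i`, whose order is higher by one.
      have e : V i - W i = -(fieldDerivation V (fieldDerivation V
          (opSum (expCoeff 2) (fieldDerivation V) (X i)))
          - fieldDerivation W (fieldDerivation W
          (opSum (expCoeff 2) (fieldDerivation W) (X i)))) := by linear_combination h5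
      rw [e]
      exact (filt _).neg_mem (filt_mono (by omega) h4)
  funext i
  exact eq_of_sub_mem_filt fun n => filt_mono (by omega) (key n i)

/-! ### The logarithm as a fixed point -/

/-- The derivation `f u ∂/∂x`. -/
abbrev multiplierDerivation (f u : Series) : Derivation ℂ Series Series :=
  fieldDerivation (horizontal (f * u))

theorem raises_multiplierDerivation {f : Series} (hf : f ∈ filt 2) (u : Series) :
    Raises 1 (multiplierDerivation f u) :=
  raises_horizontal ((filt 2).mul_mem_right _ hf)

/-- The map whose fixed points `u` satisfy `exp(f u ∂/∂x)(x) = x + f G`. -/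
def logMap (f G u : Series) : Series :=
  G - u * pderiv ℂ 0 (multiplierDerivation f u (opSum (expCoeff 2) (multiplierDerivation f u) x))

theorem isContraction_logMap {f : Series} (hf : f ∈ filt 2) (G : Series) :
    IsContraction (logMap f G) := by
  intro n u u' h
  have hD := raises_multiplierDerivation hf u
  have hD' := raises_multiplierDerivation hf u'
  have hsub : Raises (n + 1) (⇑(multiplierDerivation f u) - ⇑(multiplierDerivation f u')) := by
    rw [sub_fieldDerivation]
    refine raises_fieldDerivation fun i => ?_
    fin_cases i
    · have := mul_mem_filt hf h
      rw [mul_sub] at this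
      exact filt_mono (by omega) this
    · simp [horizontal]
  have h1 := opSum_sub_opSum_mem_filt hD hD' hsub (expCoeff 2) (X_mem_filt 0)
  have h2 := opSum_mem_filt hD' (expCoeff 2) (X_mem_filt 0)
  have h3 := raises_sub_mem_filt hD hsub (filt_mono (by omega) h1) h2
  have h4 := hD' _ _ h2
  have e : ∀ a b : Series, logMap f G u - logMap f G u' = G - u * a - (G - u' * b) →
      logMap f G u - logMap f G u' = -(u * (a - b) + (u - u') * b) := by
    intro a b hab
    rw [hab]
    ring
  rw [e _ _ rfl, ← map_sub]
  refine (filt _).neg_mem ((filt _).add_mem ((filt _).mul_mem_left _ ?_) ?_)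
  · exact pderiv_mem_filt 0 (filt_mono (by omega) h3)
  · exact mul_mem_filt h (pderiv_mem_filt 0 h4)

theorem logMap_sub_mem_filt {f : Series} (hf : f ∈ filt 2) (G u : Series) :
    logMap f G u - G ∈ filt 1 := by
  have hD := raises_multiplierDerivation hf u
  have h := hD _ _ (opSum_mem_filt hD (expCoeff 2) (X_mem_filt 0))
  rw [logMap, sub_sub_cancel_left]
  exact (filt _).neg_mem ((filt _).mul_mem_left _ (pderiv_mem_filt 0 h))

/-- Valid for every `u`: at a fixed point it yields `x + f G`, and along an arbitrary family it
computes the derivative of `logMap` from that of the exponential. -/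
theorem opSum_exp_multiplierDerivation {f : Series} (hf : f ∈ filt 2) (G u : Series) :
    opSum (expCoeff 0) (multiplierDerivation f u) x = x + f * (G - logMap f G u + u) := by
  rw [opSum_expCoeff_zero (raises_multiplierDerivation hf u), fieldDerivation_X,
    fieldDerivation_horizontal, logMap]
  simp only [horizontal, Matrix.cons_val_zero]
  ring

theorem fieldExp_horizontal_one {v : Series} (hv : v ∈ filt 2) : fieldExp (horizontal v) 1 = y := by
  have hV := horizontal_mem_filt hv
  have hD := raises_fieldDerivation hV
  rw [fieldExp_apply hV, opSum_expCoeff 0 hD, map_opSum hD, fieldDerivation_X]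
  have : opSum (expCoeff 1) (fieldDerivation (horizontal v)) (horizontal v 1) = 0 := by
    have := opSum_sub (expCoeff 1) (fieldDerivation (horizontal v)) 0 0
    simpa [horizontal] using this
  simp [this]

/-- The infinitesimal generator of `(x, y) ↦ (x + f G, y)`. -/
theorem fieldLog_eq {f : Series} (hf : f ∈ filt 2) {G u : Series} (hu : logMap f G u = u)
    {φ : FormalMap} (h0 : φ 0 = x + f * G) (h1 : φ 1 = y) : fieldLog φ = horizontal (f * u) := by
  have hv : f * u ∈ filt 2 := (filt 2).mul_mem_right _ hf
  have hV := horizontal_mem_filt hv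
  have hφ : ∀ i, φ i - X i ∈ filt 2 := fun i => by
    fin_cases i
    · simpa [h0] using (filt 2).mul_mem_right _ hf
    · simp [h1]
  have hgen : IsGenerator φ (horizontal (f * u)) := by
    refine ⟨⟨fun i => (mem_filt_two.1 (hV i)).1, ?_⟩, ?_⟩
    · have : linearPart (horizontal (f * u)) = 0 := by
        ext i j
        rw [linearPart_apply, (mem_filt_two.1 (hV i)).2 j, Matrix.zero_apply]
      rw [this]
      exact IsNilpotent.zero
    · funext i
      fin_cases i
      · have := opSum_exp_multiplierDerivation hf G u
        rw [hu, sub_add_cancel, ← h0] at this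
        exact (fieldExp_apply hV 0).trans this
      · exact (fieldExp_horizontal_one hv).trans h1.symm
  have hlog : IsGenerator φ (fieldLog φ) := Classical.epsilon_spec ⟨_, hgen⟩
  exact eq_of_fieldExp_eq (hlog.mem_filt_two hφ) hV (hlog.2.trans hgen.2.symm)

theorem constantCoeff_eq_of_logMap_eq {f : Series} (hf : f ∈ filt 2) {G u : Series}
    (hu : logMap f G u = u) : constantCoeff u = constantCoeff G := by
  have h := mem_filt_one.1 (logMap_sub_mem_filt hf G u)
  rwa [hu, map_sub, sub_eq_zero] at h

theorem pderiv_mul_inv_eq_one {f : Series} (hf : f ∈ filt 2) (G : Series) {φ : FormalMap}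
    (h0 : φ 0 = x + f * G) : pderiv ℂ 0 (φ 0) * (pderiv ℂ 0 (φ 0))⁻¹ = 1 := by
  refine MvPowerSeries.mul_inv_cancel _ ?_
  have := (mem_filt_two.1 ((filt 2).mul_mem_right G hf)).2 0
  rw [h0, map_add, map_add, this]
  simp

theorem unitFactor_eq {f : Series} (hf : f ∈ filt 2) (hf0 : f ≠ 0) {G u : Series}
    (hu : logMap f G u = u) {φ : FormalMap} (h0 : φ 0 = x + f * G) (h1 : φ 1 = y) :
    unitFactor f φ = u := by
  have hlog := fieldLog_eq hf hu h0 h1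
  have happ : (fieldLog φ).apply x = u * f := by
    rw [hlog, ← coe_fieldDerivation, fieldDerivation_X, mul_comm]
    rfl
  have : (fieldLog φ).apply x = unitFactor f φ * f :=
    Classical.epsilon_spec (p := fun u => (fieldLog φ).apply x = u * f) ⟨u, happ⟩
  -- As `f ≠ 0`, the factor chosen by `unitFactor` is the only possible one.
  exact mul_right_cancel₀ hf0 (this.symm.trans happ)

/-! ### Coefficientwise derivatives -/

/-- The family `F` is differentiable at `0` coefficient by coefficient, with derivative `F'`. -/
def HasCoeffDeriv (F : ℂ → Series) (F' : Series) : Prop :=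
  ∀ d, HasDerivAt (fun μ => coeff d (F μ)) (coeff d F') 0

namespace HasCoeffDeriv

variable {F G : ℂ → Series} {F' G' : Series}

theorem unique (h : HasCoeffDeriv F F') (h' : HasCoeffDeriv F G') : F' = G' := by
  ext d
  exact (h d).unique (h' d)

theorem const (g : Series) : HasCoeffDeriv (fun _ => g) 0 := fun d => by
  simpa using hasDerivAt_const (0 : ℂ) (coeff d g)

theorem add (hF : HasCoeffDeriv F F') (hG : HasCoeffDeriv G G') :
    HasCoeffDeriv (fun μ => F μ + G μ) (F' + G') := fun d => by
  simpa only [map_add] using! (hF d).add (hG d)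

theorem sub (hF : HasCoeffDeriv F F') (hG : HasCoeffDeriv G G') :
    HasCoeffDeriv (fun μ => F μ - G μ) (F' - G') := fun d => by
  simpa only [map_sub] using! (hF d).sub (hG d)

theorem mul (hF : HasCoeffDeriv F F') (hG : HasCoeffDeriv G G') :
    HasCoeffDeriv (fun μ => F μ * G μ) (F' * G 0 + F 0 * G') := fun d => by
  simp only [map_add, coeff_mul, ← Finset.sum_add_distrib]
  exact HasDerivAt.fun_sum fun p _ => (hF p.1).mul (hG p.2)

theorem const_mul (g : Series) (hF : HasCoeffDeriv F F') :
    HasCoeffDeriv (fun μ => g * F μ) (g * F') := by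
  simpa using (const g).mul hF

theorem pderiv (i : Fin 2) (hF : HasCoeffDeriv F F') :
    HasCoeffDeriv (fun μ => MvPowerSeries.pderiv ℂ i (F μ)) (MvPowerSeries.pderiv ℂ i F') :=
  fun d => by
    simp only [coeff_pderiv]
    exact (hF _).mul_const _

/-- A fixed point of a family of contractions inherits the derivative that is preserved by the
family. -/
theorem of_isContraction {T : ℂ → Series → Series} (hT : ∀ μ, IsContraction (T μ))
    (hF : ∀ μ, T μ (F μ) = F μ)
    (H : ∀ w : ℂ → Series, w 0 = F 0 → HasCoeffDeriv w F' →
      HasCoeffDeriv (fun μ => T μ (w μ)) F') : HasCoeffDeriv F F' := by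
  have key : ∀ n : ℕ, ∀ d : Fin 2 →₀ ℕ, d.degree < n →
      HasDerivAt (fun μ => coeff d (F μ)) (coeff d F') 0 := by
    intro n
    induction n with
    | zero => exact fun d hd => absurd hd (Nat.not_lt_zero _)
    | succ n ih =>
      intro d hd
      -- `w` agrees with `F` in degrees below `n`, where differentiability is known, and is affine
      -- with slope `F'` above. The contraction `T μ` maps `w μ` to a series agreeing with `F μ` up
      -- to degree `n` inclusive.
      let w : ℂ → Series := fun μ e =>
        if e.degree < n then coeff e (F μ) else coeff e (F 0) + μ * coeff e F'
      have hw : ∀ μ e, coeff e (w μ)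
        = if e.degree < n then coeff e (F μ) else coeff e (F 0) + μ * coeff e F' := fun _ _ => rfl
      have hw0 : w 0 = F 0 := by
        ext e
        rw [hw]
        split_ifs <;> simp
      have hwd : HasCoeffDeriv w F' := by
        intro e
        simp only [hw]
        by_cases he : e.degree < n
        · simpa only [he, if_true] using ih e he
        · simp only [he, if_false]
          simpa using ((hasDerivAt_id (0 : ℂ)).mul_const (coeff e F')).const_add (coeff e (F 0))
      have hsub : ∀ μ, F μ - w μ ∈ filt n := by
        intro μ e he
        rw [map_sub, hw, if_pos he, sub_self]
      have heq : ∀ μ, coeff d (F μ) = coeff d (T μ (w μ)) := by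
        intro μ
        have := hT μ n _ _ (hsub μ) d hd
        rwa [hF, map_sub, sub_eq_zero] at this
      simp only [heq]
      exact H w hw0 hwd d
  exact fun d => key (d.degree + 1) d (Nat.lt_succ_self _)

/-- The inverse of `F μ` is the fixed point of `w ↦ 1 - (F μ - 1) w`, a contraction because `F μ -
1` has no constant term. -/
theorem inv (hF : HasCoeffDeriv F F') (h1 : ∀ μ, constantCoeff (F μ) = 1) :
    HasCoeffDeriv (fun μ => (F μ)⁻¹) (-F' * (F 0)⁻¹ ^ 2) := by
  have hinv : ∀ μ, F μ * (F μ)⁻¹ = 1 := fun μ =>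
    MvPowerSeries.mul_inv_cancel _ (by rw [h1]; exact one_ne_zero)
  refine of_isContraction (T := fun μ w => 1 - (F μ - 1) * w) (fun μ n g h hgh => ?_)
    (fun μ => ?_) fun w hw0 hw => ?_
  · have h2 : F μ - 1 ∈ filt 1 := mem_filt_one.2 (by simp [h1])
    have := (filt _).neg_mem (mul_mem_filt h2 hgh)
    rw [add_comm 1 n] at this
    convert this using 1
    ring
  · linear_combination -hinv μ
  · have := (const 1).sub ((hF.sub (const 1)).mul hw)
    convert this using 1
    rw [hw0]
    linear_combination (-F' * (F 0)⁻¹) * hinv 0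

end HasCoeffDeriv

theorem coeff_map_opSum {D Y : Derivation ℂ Series Series} (hD : Raises 1 D) (hY : Raises 1 Y)
    (c : ℕ → ℂ) (g : Series) (d : Fin 2 →₀ ℕ) : coeff d (Y (opSum c D g))
      = ∑ j ∈ Finset.range (d.degree + 1), c j * coeff d (Y (D^[j] g)) := by
  have h := hY _ _ (opSum_sub_mem_filt hD c g (d.degree + 1)) d (by omega)
  rw [map_sub, map_sub, sub_eq_zero] at h
  rw [h, map_sum, map_sum]
  simp

/-- The derivative of `∑ j, c j • X_μ^j` when the derivative of the vector field `X_μ` is a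
commutator `[Y, X_0]`. -/
theorem hasCoeffDeriv_opSum {V : ℂ → Series} {V' : Series} (hV : HasCoeffDeriv V V')
    (hV2 : ∀ μ, V μ ∈ filt 2) {Y : Derivation ℂ Series Series} (hY : Raises 1 Y)
    (hcomm : ∀ g, Y (fieldDerivation (horizontal (V 0)) g)
      - fieldDerivation (horizontal (V 0)) (Y g) = V' * pderiv ℂ 0 g) (c : ℕ → ℂ) (g : Series) :
    HasCoeffDeriv (fun μ => opSum c (fieldDerivation (horizontal (V μ))) g)
      (Y (opSum c (fieldDerivation (horizontal (V 0))) g)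
        - opSum c (fieldDerivation (horizontal (V 0))) (Y g)) := by
  set D := fieldDerivation (horizontal (V 0)) with hD
  -- When `X_0' = [Y, D]`, the Leibniz sum for the derivative of `X_μ^j` telescopes to `[Y, D^j]`.
  have key : ∀ j, HasCoeffDeriv (fun μ => (fieldDerivation (horizontal (V μ)))^[j] g)
      (Y (D^[j] g) - D^[j] (Y g)) := by
    intro j
    induction j with
    | zero => simpa using HasCoeffDeriv.const g
    | succ j ih =>
      simp only [Function.iterate_succ_apply', fieldDerivation_horizontal]
      have h := hV.mul (ih.pderiv 0)
      convert h using 1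
      rw [← hcomm, ← fieldDerivation_horizontal (V 0), ← hD, map_sub]
      ring
  intro d
  rw [map_sub, coeff_map_opSum (raises_horizontal (hV2 0)) hY, coeff_opSum,
    ← Finset.sum_sub_distrib]
  simp only [coeff_opSum, ← mul_sub, ← map_sub]
  exact HasDerivAt.fun_sum fun j _ => (key j d).const_mul (c j)

/-! ### Comparison of the derived and the reduced derived equations -/

theorem exists_pderiv_eq (h : Series) : ∃ γ : Series, pderiv ℂ 0 γ = h := by
  let γ : Series := fun d => coeff (d - Finsupp.single 0 1) h / (d 0 : ℂ)
  have hγ : ∀ d, coeff d γ = coeff (d - Finsupp.single 0 1) h / (d 0 : ℂ) := fun _ => rfl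
  refine ⟨γ, ?_⟩
  ext d
  have h1 : ((d 0 : ℕ) : ℂ) + 1 ≠ 0 := Nat.cast_add_one_ne_zero _
  rw [coeff_pderiv, hγ, add_tsub_cancel_right, Finsupp.add_apply, Finsupp.single_eq_same,
    Nat.cast_add, Nat.cast_one, div_mul_cancel₀ _ h1]

/-- Since `exp(D) - 1 = D (1 + D E₂)`, it suffices to solve `α + D E₂ α = γ`. The map `a ↦ γ - D E₂
a` is a contraction, and `β = -E₂ α`. -/
theorem exists_opSum_exp_sub_eq {D : Derivation ℂ Series Series} (hD : Raises 1 D) (γ : Series) :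
    ∃ α β, α - γ = D β ∧ opSum (expCoeff 0) D α - α = D γ := by
  obtain ⟨α, hα⟩ := IsContraction.exists_fixedPoint
    (T := fun a => γ - D (opSum (expCoeff 2) D a)) (fun n g h hgh => by
      have := (filt _).neg_mem (hD _ _ (opSum_mem_filt hD (expCoeff 2) hgh))
      rw [opSum_sub, map_sub] at this
      convert this using 1
      ring)
  refine ⟨α, -opSum (expCoeff 2) D α, by rw [map_neg]; linear_combination -hα, ?_⟩
  rw [opSum_expCoeff_zero hD]
  have := congrArg D hα
  rw [map_sub] at this
  linear_combination -this

/-- Here `u` enters only as a factor and through a single `opSum`, so the product rule and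
`hasCoeffDeriv_opSum` differentiate it. -/
theorem logMap_eq {f : Series} (hf : f ∈ filt 2) (G u : Series) : logMap f G u
    = G - u * pderiv ℂ 0 (opSum (expCoeff 1) (multiplierDerivation f u) x - x) := by
  rw [logMap, opSum_expCoeff 1 (raises_multiplierDerivation hf u)]
  simp

/-- The solutions of the derived and of the reduced derived equations agree modulo `f`. -/
theorem exists_isDerivedSolution {f : Series} (hf : f ∈ filt 2) (hf0 : f ≠ 0) {G : Series}
    (hG : constantCoeff G = 1) {φ₀ : FormalMap} (h0 : φ₀ 0 = x + f * G) (h1 : φ₀ 1 = y)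
    {Δ γ : Series} (hγ : IsReducedSolution f φ₀ Δ γ) :
    ∃ α h, IsDerivedSolution f φ₀ Δ α ∧ α - γ = f * h := by
  have hex : ∀ μ : ℂ, ∃ u, logMap f (G + C μ * f * Δ) u = u := fun μ =>
    (isContraction_logMap hf _).exists_fixedPoint
  choose u hu using hex
  have hu1 : ∀ μ, constantCoeff (u μ) = 1 := by
    intro μ
    have hfc : constantCoeff f = 0 := mem_filt_one.1 (filt_mono one_le_two hf)
    rw [constantCoeff_eq_of_logMap_eq hf (hu μ)]
    simp [hG, hfc]
  have hfam : ∀ μ, unitFactor f (family f φ₀ Δ μ) = u μ := fun μ => by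
    refine unitFactor_eq hf hf0 (hu μ) ?_ rfl
    change φ₀ 0 + C μ * f ^ 2 * Δ = _
    rw [h0]
    ring
  have hu0 : logMap f G (u 0) = u 0 := by simpa using hu 0
  have hunit : unitFactor f φ₀ = u 0 := unitFactor_eq hf hf0 hu0 h0 h1
  have huinv : u 0 * (u 0)⁻¹ = 1 :=
    MvPowerSeries.mul_inv_cancel _ (by rw [hu1]; exact one_ne_zero)
  set D := multiplierDerivation f (u 0) with hDdef
  have hD : Raises 1 D := raises_multiplierDerivation hf (u 0)
  have hDapp : ∀ g, D g = f * u 0 * pderiv ℂ 0 g := fieldDerivation_horizontal _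
  have hexp : opSum (expCoeff 0) D x = φ₀ 0 := by
    rw [hDdef, opSum_exp_multiplierDerivation hf G, hu0, h0, sub_add_cancel]
  have hφinv : pderiv ℂ 0 (φ₀ 0) * (pderiv ℂ 0 (φ₀ 0))⁻¹ = 1 :=
    pderiv_mul_inv_eq_one hf G h0
  obtain ⟨α, β, hαβ, hα⟩ := exists_opSum_exp_sub_eq hD γ
  have hu' : HasCoeffDeriv u (f * u 0 ^ 2 * pderiv ℂ 0 α) := by
    refine HasCoeffDeriv.of_isContraction (T := fun μ => logMap f (G + C μ * f * Δ))
      (fun μ => isContraction_logMap hf _) hu fun w hw0 hw => ?_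
    have hV := hw.const_mul f
    have hV2 : ∀ μ, f * w μ ∈ filt 2 := fun μ => (filt 2).mul_mem_right _ hf
    -- `Y = -α D`, so `[Y, D] = D(α) D`; this is the variation of `f w_μ ∂/∂x` when `w` has the
    -- claimed derivative `f u₀² ∂α/∂x`.
    let Y := fieldDerivation (horizontal (-α * (f * u 0)))
    have hYapp : ∀ g, Y g = -α * (f * u 0) * pderiv ℂ 0 g := fieldDerivation_horizontal _
    have hY : Raises 1 Y :=
      raises_horizontal ((filt 2).mul_mem_left _ ((filt 2).mul_mem_right _ hf))
    have hcomm : ∀ g, Y (D g) - D (Y g) = f * (f * u 0 ^ 2 * pderiv ℂ 0 α) * pderiv ℂ 0 g := by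
      intro g
      simp only [hYapp, hDapp, Derivation.leibniz, smul_eq_mul, map_neg]
      ring
    have hop : ∀ c, HasCoeffDeriv (fun μ => opSum c (multiplierDerivation f (w μ)) x)
        (Y (opSum c D x) - opSum c D (Y x)) := fun c => by
      have := hasCoeffDeriv_opSum hV hV2 hY (by simpa only [hw0] using hcomm) c x
      simpa only [hw0] using this
    have hGd : HasCoeffDeriv (fun μ => G + C μ * f * Δ) (f * Δ) := fun d => by
      have e : ∀ μ : ℂ, coeff d (G + C μ * f * Δ) = coeff d G + μ * coeff d (f * Δ) := fun μ => by
        rw [map_add, mul_assoc, coeff_C_mul]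
      simp only [e]
      simpa using ((hasDerivAt_id (0 : ℂ)).mul_const (coeff d (f * Δ))).const_add (coeff d G)
    -- Only the existence of the derivative `L` is taken from the formula. Its value follows by
    -- differentiating `exp(f w_μ ∂/∂x)(x)` in two ways, `hE` and `hE'`.
    obtain ⟨L, hL⟩ : ∃ L, HasCoeffDeriv (fun μ => logMap f (G + C μ * f * Δ) (w μ)) L := by
      simp only [logMap_eq hf]
      exact ⟨_, hGd.sub (hw.mul (((hop (expCoeff 1)).sub (HasCoeffDeriv.const x)).pderiv 0))⟩
    have hE := hop (expCoeff 0)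
    have hE' := (HasCoeffDeriv.const x).add (((hGd.sub hL).add hw).const_mul f)
    simp only [← opSum_exp_multiplierDerivation hf] at hE'
    -- Multiplicativity of `exp(D)` turns the left side into `(exp(D)α - α) D(x ∘ φ₀) = Dγ · D(x ∘
    -- φ₀)`, and the reduced equation for `γ` evaluates it.
    have hcancel : Y (opSum (expCoeff 0) D x) - opSum (expCoeff 0) D (Y x) = f * (f * Δ) := by
      have hYx : Y x = -α * D x := by rw [hYapp, hDapp]; ring
      have hEV : opSum (expCoeff 0) D (D x) = f * u 0 * pderiv ℂ 0 (φ₀ 0) := by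
        rw [← map_opSum hD, hexp, hDapp]
      have hneg : opSum (expCoeff 0) D (-α) = -opSum (expCoeff 0) D α := by
        have h := opSum_sub (expCoeff 0) D 0 α
        have h' := opSum_sub (expCoeff 0) D 0 0
        simp only [sub_self] at h'
        rwa [h', zero_sub, zero_sub] at h
      rw [hYx, opSum_exp_mul hD, hEV, hneg, hexp, hYapp]
      have hDγ : D γ = f * u 0 * ((pderiv ℂ 0 (φ₀ 0))⁻¹ * (Δ * ((u 0)⁻¹) ^ 2)) := by
        rw [hDapp, hγ, hunit]
      rw [hDγ] at hα
      linear_combination (f * u 0 * pderiv ℂ 0 (φ₀ 0)) * hα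
        + f ^ 2 * Δ * (u 0 * (u 0)⁻¹) ^ 2 * hφinv
        + f ^ 2 * Δ * (u 0 * (u 0)⁻¹ + 1) * huinv
    have hu := hE.unique hE'
    rw [hcancel, zero_add] at hu
    have hLeq := mul_left_cancel₀ hf0 hu
    have : L = f * u 0 ^ 2 * pderiv ℂ 0 α := by linear_combination hLeq
    rwa [this] at hL
  refine ⟨α, u 0 * pderiv ℂ 0 β, fun d => ?_, by rw [hαβ, hDapp]; ring⟩
  have h := (HasCoeffDeriv.const (unitFactor f (fieldExp (horizontal f)))⁻¹).sub (hu'.inv hu1)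
  have e : 0 - -(f * u 0 ^ 2 * pderiv ℂ 0 α) * (u 0)⁻¹ ^ 2 = f * pderiv ℂ 0 α := by
    linear_combination (f * pderiv ℂ 0 α * (u 0 * (u 0)⁻¹ + 1)) * huinv
  rw [e] at h
  simpa only [homologicalNumerator, hfam] using h d

/-! ### Transport between the two curves -/

/-- The exponent of the monomial `x^i y^j`. -/
def bidegree (i j : ℕ) : Fin 2 →₀ ℕ := Finsupp.single 0 i + Finsupp.single 1 j

@[simp] theorem bidegree_zero (i j : ℕ) : bidegree i j 0 = i := by simp [bidegree]

@[simp] theorem bidegree_one (i j : ℕ) : bidegree i j 1 = j := by simp [bidegree]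

theorem bidegree_self (d : Fin 2 →₀ ℕ) : bidegree (d 0) (d 1) = d := by
  ext i
  fin_cases i <;> simp

theorem bidegree_eq_iff {i j : ℕ} {d : Fin 2 →₀ ℕ} : bidegree i j = d ↔ i = d 0 ∧ j = d 1 := by
  constructor
  · rintro rfl
    simp
  · rintro ⟨rfl, rfl⟩
    exact bidegree_self d

theorem hasSubst_diagonal : HasSubst (![PowerSeries.X, PowerSeries.X] : Fin 2 → PowerSeries ℂ) :=
  hasSubst_of_constantCoeff_zero fun s => by
    fin_cases s <;> exact PowerSeries.constantCoeff_X

theorem hasSubst_axis : HasSubst (![0, PowerSeries.X] : Fin 2 → PowerSeries ℂ) :=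
  hasSubst_of_constantCoeff_zero fun s => by
    fin_cases s
    · exact map_zero _
    · exact PowerSeries.constantCoeff_X

theorem coeff_subst_diagonal (α : Series) (n : ℕ) :
    PowerSeries.coeff n (subst (![PowerSeries.X, PowerSeries.X] : Fin 2 → PowerSeries ℂ) α)
      = ∑ p ∈ Finset.HasAntidiagonal.antidiagonal n, coeff (bidegree p.1 p.2) α := by
  classical
  have hprod : ∀ d : Fin 2 →₀ ℕ, PowerSeries.coeff n (d.prod fun s e =>
      (![PowerSeries.X, PowerSeries.X] : Fin 2 → PowerSeries ℂ) s ^ e)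
      = if n = d 0 + d 1 then 1 else 0 := by
    intro d
    rw [Finsupp.prod_fintype _ _ (by simp), Fin.prod_univ_two]
    simp [← pow_add, PowerSeries.coeff_X_pow]
  have h := coeff_subst hasSubst_diagonal α (Finsupp.single () n)
  have h' : PowerSeries.coeff n (subst (![PowerSeries.X, PowerSeries.X] : Fin 2 → PowerSeries ℂ) α)
      = ∑ᶠ d : Fin 2 →₀ ℕ, coeff d α • PowerSeries.coeff n (d.prod fun s e =>
      (![PowerSeries.X, PowerSeries.X] : Fin 2 → PowerSeries ℂ) s ^ e) := h
  rw [h']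
  simp only [hprod]
  rw [finsum_eq_sum_of_support_subset (s := (Finset.HasAntidiagonal.antidiagonal n).image
    fun p : ℕ × ℕ => bidegree p.1 p.2)]
  · rw [Finset.sum_image]
    · refine Finset.sum_congr rfl fun p hp => ?_
      rw [Finset.HasAntidiagonal.mem_antidiagonal] at hp
      simp [hp]
    · intro p _ q _ hpq
      have := bidegree_eq_iff.1 hpq
      simpa [Prod.ext_iff] using this
  · intro d hd
    rw [Finset.coe_image]
    refine ⟨(d 0, d 1), ?_, bidegree_self d⟩
    by_contra hne
    apply hd
    have : ¬ n = d 0 + d 1 := fun h => hne (by simp [h])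
    simp [this]

theorem coeff_subst_axis (α : Series) (n : ℕ) :
    PowerSeries.coeff n (subst (![0, PowerSeries.X] : Fin 2 → PowerSeries ℂ) α)
      = coeff (bidegree 0 n) α := by
  classical
  have hprod : ∀ d : Fin 2 →₀ ℕ, PowerSeries.coeff n (d.prod fun s e =>
      (![0, PowerSeries.X] : Fin 2 → PowerSeries ℂ) s ^ e)
      = if d = bidegree 0 n then 1 else 0 := by
    intro d
    rw [Finsupp.prod_fintype _ _ (by simp), Fin.prod_univ_two]
    have hiff : d = bidegree 0 n ↔ d 0 = 0 ∧ n = d 1 := by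
      rw [eq_comm, bidegree_eq_iff, eq_comm]
    by_cases h0 : d 0 = 0
    · simp [hiff, h0, PowerSeries.coeff_X_pow]
    · simp [hiff, h0]
  have h := coeff_subst hasSubst_axis α (Finsupp.single () n)
  have h' : PowerSeries.coeff n (subst (![0, PowerSeries.X] : Fin 2 → PowerSeries ℂ) α)
      = ∑ᶠ d : Fin 2 →₀ ℕ, coeff d α • PowerSeries.coeff n (d.prod fun s e =>
      (![0, PowerSeries.X] : Fin 2 → PowerSeries ℂ) s ^ e) := h
  rw [h']
  simp only [hprod]
  rw [finsum_eq_single _ (bidegree 0 n)]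
  · simp
  · intro d hd
    simp [hd]

/-- The transport is `∫_0^y ∂α/∂x dx`, and `x^i y^j` integrates to `y^(i+j+1) / (i + 1)`. -/
theorem coeff_succ_transport (α : Series) (n : ℕ) :
    PowerSeries.coeff (n + 1) (transport α) = ∑ p ∈ Finset.HasAntidiagonal.antidiagonal n,
      coeff (bidegree p.1 p.2) (pderiv ℂ 0 α) / ((p.1 : ℂ) + 1) := by
  rw [transport, map_sub, coeff_subst_diagonal, coeff_subst_axis,
    Finset.Nat.sum_antidiagonal_succ, add_sub_cancel_left]
  refine Finset.sum_congr rfl fun p _ => ?_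
  rw [coeff_pderiv, bidegree_zero, mul_div_cancel_right₀ _ (Nat.cast_add_one_ne_zero p.1)]
  congr 2
  rw [bidegree_eq_iff]
  simp

theorem coeff_zero_transport (α : Series) : PowerSeries.coeff 0 (transport α) = 0 := by
  rw [transport, map_sub, coeff_subst_diagonal, coeff_subst_axis]
  simp

theorem transport_congr {α β : Series} (h : pderiv ℂ 0 α = pderiv ℂ 0 β) :
    transport α = transport β := by
  ext n
  cases n with
  | zero => rw [coeff_zero_transport, coeff_zero_transport]
  | succ n => rw [coeff_succ_transport, coeff_succ_transport, h]

/-- `x^a (x - y)^b` vanishes on both curves `x = 0` and `x = y`, as both exponents are positive. -/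
theorem transport_eq_of_sub_eq_mul {a b : ℕ} (ha : 0 < a) (hb : 0 < b) {α β h : Series}
    (H : α - β = twoCurves a b * h) : transport α = transport β := by
  have e : α = β + twoCurves a b * h := by linear_combination H
  have h1 : subst (![PowerSeries.X, PowerSeries.X] : Fin 2 → PowerSeries ℂ) (twoCurves a b * h)
      = 0 := by
    rw [subst_mul hasSubst_diagonal, twoCurves, subst_mul hasSubst_diagonal,
      subst_pow hasSubst_diagonal, subst_pow hasSubst_diagonal, subst_sub hasSubst_diagonal,
      subst_X hasSubst_diagonal, subst_X hasSubst_diagonal]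
    simp [hb.ne']
  have h2 : subst (![0, PowerSeries.X] : Fin 2 → PowerSeries ℂ) (twoCurves a b * h) = 0 := by
    rw [subst_mul hasSubst_axis, twoCurves, subst_mul hasSubst_axis,
      subst_pow hasSubst_axis, subst_pow hasSubst_axis, subst_sub hasSubst_axis,
      subst_X hasSubst_axis, subst_X hasSubst_axis]
    simp [ha.ne']
  rw [e, transport, subst_add hasSubst_diagonal, subst_add hasSubst_axis, h1, h2, add_zero,
    add_zero, transport]

theorem twoCurves_mem_filt {a b : ℕ} (ha : 0 < a) (hb : 0 < b) : twoCurves a b ∈ filt 2 := by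
  have h1 : x ^ a ∈ filt 1 := Ideal.pow_mem_of_mem _ (X_mem_filt 0) a ha
  have h2 : (x - y) ^ b ∈ filt 1 :=
    Ideal.pow_mem_of_mem _ ((filt 1).sub_mem (X_mem_filt 0) (X_mem_filt 1)) b hb
  exact mul_mem_filt h1 h2

theorem twoCurves_ne_zero (a b : ℕ) : twoCurves a b ≠ 0 := by
  have hx : x ≠ 0 := by
    intro h
    have := congrArg (pderiv ℂ 0) h
    simp at this
  have hxy : x - y ≠ 0 := by
    intro h
    have := congrArg (pderiv ℂ 0) h
    simp at this
  exact mul_ne_zero (pow_ne_zero a hx) (pow_ne_zero b hxy)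

theorem exists_eq_of_mem_DPrime {f : Series} (hf : f ∈ filt 2) {φ : FormalMap}
    (hφ : φ ∈ DPrime f) : ∃ G, constantCoeff G = 1 ∧ φ 0 = x + f * G ∧ φ 1 = y := by
  obtain ⟨⟨_, h1, _⟩, g, _, hg⟩ := hφ
  have hV := horizontal_mem_filt hf
  -- With `G = 0` and `u = 1` the formula expresses `exp(f ∂/∂x)(x)` as `x + f (1 - logMap f 0 1)`.
  have h := opSum_exp_multiplierDerivation hf 0 1
  rw [multiplierDerivation, mul_one] at h
  rw [fieldExp_apply hV, h] at hg
  refine ⟨1 - logMap f 0 1 + f * g, ?_, by linear_combination hg, h1⟩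
  have h2 := mem_filt_one.1 (logMap_sub_mem_filt hf 0 1)
  rw [sub_zero] at h2
  have hfc : constantCoeff f = 0 := mem_filt_one.1 (filt_mono one_le_two hf)
  simp [h2, hfc]

/-- The weight `w` for which the reduced derived equation is `∂α/∂x = w Δ`. -/
def weight (f : Series) (φ₀ : FormalMap) : Series :=
  (pderiv ℂ 0 (φ₀ 0))⁻¹ * ((unitFactor f φ₀)⁻¹) ^ 2

theorem exists_isReducedSolution (f : Series) (φ₀ : FormalMap) (Δ : Series) :
    ∃ γ, IsReducedSolution f φ₀ Δ γ :=
  exists_pderiv_eq _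

theorem coeff_succ_reducedOperator (a b : ℕ) (φ₀ : FormalMap) (Δ : Series) (n : ℕ) :
    PowerSeries.coeff (n + 1) (reducedOperator a b φ₀ Δ)
      = ∑ p ∈ Finset.HasAntidiagonal.antidiagonal n,
        coeff (bidegree p.1 p.2) (weight (twoCurves a b) φ₀ * Δ) / ((p.1 : ℂ) + 1) := by
  have h : IsReducedSolution (twoCurves a b) φ₀ Δ _ :=
    Classical.epsilon_spec (exists_isReducedSolution (twoCurves a b) φ₀ Δ)
  rw [reducedOperator, coeff_succ_transport, h, weight]
  simp only [mul_comm Δ, mul_assoc]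

theorem derivedOperator_eq_reducedOperator {a b : ℕ} (ha : 0 < a) (hb : 0 < b) {φ₀ : FormalMap}
    (hφ₀ : φ₀ ∈ DPrime (twoCurves a b)) (Δ : Series) :
    derivedOperator a b φ₀ Δ = reducedOperator a b φ₀ Δ := by
  have hf := twoCurves_mem_filt ha hb
  have hf0 := twoCurves_ne_zero a b
  obtain ⟨G, hG, h0, h1⟩ := exists_eq_of_mem_DPrime hf hφ₀
  have hγ : IsReducedSolution (twoCurves a b) φ₀ Δ _ :=
    Classical.epsilon_spec (exists_isReducedSolution (twoCurves a b) φ₀ Δ)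
  obtain ⟨α, h, hα, hαγ⟩ := exists_isDerivedSolution hf hf0 hG h0 h1 hγ
  have hα' : IsDerivedSolution (twoCurves a b) φ₀ Δ _ := Classical.epsilon_spec ⟨α, hα⟩
  have heq := mul_left_cancel₀ hf0 (HasCoeffDeriv.unique hα' hα)
  rw [derivedOperator, reducedOperator, transport_congr heq, transport_eq_of_sub_eq_mul ha hb hαγ]

/-- The last identity is what recovers the convergence of `û` from that of the weight. -/
theorem fieldLog_eq_of_mem_DPrime {f : Series} (hf : f ∈ filt 2) (hf0 : f ≠ 0) {φ₀ : FormalMap}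
    (hφ₀ : φ₀ ∈ DPrime f) : fieldLog φ₀ = horizontal (f * unitFactor f φ₀) ∧
      constantCoeff (unitFactor f φ₀) = 1 ∧
      unitFactor f φ₀ ^ 2 * (weight f φ₀ * pderiv ℂ 0 (φ₀ 0)) = 1 := by
  obtain ⟨G, hG, h0, h1⟩ := exists_eq_of_mem_DPrime hf hφ₀
  obtain ⟨u, hu⟩ := (isContraction_logMap hf G).exists_fixedPoint
  have hu1 : constantCoeff u = 1 := (constantCoeff_eq_of_logMap_eq hf hu).trans hG
  have huinv : u * u⁻¹ = 1 := MvPowerSeries.mul_inv_cancel _ (by rw [hu1]; exact one_ne_zero)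
  have hφinv : pderiv ℂ 0 (φ₀ 0) * (pderiv ℂ 0 (φ₀ 0))⁻¹ = 1 :=
    pderiv_mul_inv_eq_one hf G h0
  rw [weight, unitFactor_eq hf hf0 hu h0 h1]
  refine ⟨fieldLog_eq hf hu h0 h1, hu1, ?_⟩
  linear_combination (u * u⁻¹) ^ 2 * hφinv + (u * u⁻¹ + 1) * huinv

/-! ### Convergent power series and weighted norms -/

/-- The weighted `ℓ¹` norm `∑ d, |g_d| r^|d|`. -/
def wnorm (r : ℝ≥0) (g : Series) : ℝ≥0∞ :=
  ∑' d : Fin 2 →₀ ℕ, ((‖coeff d g‖₊ * r ^ d.degree : ℝ≥0) : ℝ≥0∞)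

theorem isConvergent_iff_wnorm {g : Series} :
    IsConvergent g ↔ ∃ r : ℝ≥0, 0 < r ∧ wnorm r g ≠ ⊤ := by
  have key : ∀ r : ℝ≥0, wnorm r g ≠ ⊤ ↔
      Summable fun d : Fin 2 →₀ ℕ => ‖coeff d g‖ * (r : ℝ) ^ d.degree := by
    intro r
    rw [wnorm, ENNReal.tsum_coe_ne_top_iff_summable, ← NNReal.summable_coe]
    simp
  constructor
  · rintro ⟨r, hr, h⟩
    exact ⟨⟨r, hr.le⟩, hr, (key _).2 h⟩
  · rintro ⟨r, hr, h⟩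
    exact ⟨r, hr, (key r).1 h⟩

theorem wnorm_add_le (r : ℝ≥0) (g h : Series) : wnorm r (g + h) ≤ wnorm r g + wnorm r h := by
  rw [wnorm, wnorm, wnorm, ← ENNReal.tsum_add]
  refine ENNReal.tsum_le_tsum fun d => ?_
  rw [← ENNReal.coe_add, ENNReal.coe_le_coe, map_add, ← add_mul]
  gcongr
  exact nnnorm_add_le _ _

theorem wnorm_mul_le (r : ℝ≥0) (g h : Series) : wnorm r (g * h) ≤ wnorm r g * wnorm r h := by
  have e : wnorm r g * wnorm r h = ∑' d : Fin 2 →₀ ℕ,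
      ∑ p ∈ Finset.HasAntidiagonal.antidiagonal d, ((‖coeff p.1 g‖₊ * r ^ p.1.degree : ℝ≥0) : ℝ≥0∞)
        * ((‖coeff p.2 h‖₊ * r ^ p.2.degree : ℝ≥0) : ℝ≥0∞) := by
    rw [wnorm, wnorm, ← ENNReal.tsum_mul_right]
    simp only [← ENNReal.tsum_mul_left]
    rw [← ENNReal.tsum_prod, ← Finset.HasAntidiagonal.sigmaAntidiagonalEquivProd.tsum_eq,
      ENNReal.tsum_sigma']
    refine tsum_congr fun d => ?_
    rw [tsum_fintype]
    exact Finset.sum_coe_sort (Finset.HasAntidiagonal.antidiagonal d)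
      fun p => ((‖coeff p.1 g‖₊ * r ^ p.1.degree : ℝ≥0) : ℝ≥0∞)
        * ((‖coeff p.2 h‖₊ * r ^ p.2.degree : ℝ≥0) : ℝ≥0∞)
  rw [e, wnorm]
  refine ENNReal.tsum_le_tsum fun d => ?_
  simp only [← ENNReal.coe_mul, ← ENNReal.ofNNReal_finsetSum, ENNReal.coe_le_coe]
  rw [coeff_mul]
  refine (mul_le_mul_left (nnnorm_sum_le _ _) _).trans ?_
  rw [Finset.sum_mul]
  refine Finset.sum_le_sum fun p hp => ?_
  rw [Finset.HasAntidiagonal.mem_antidiagonal] at hp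
  rw [nnnorm_mul, ← hp, map_add, pow_add]
  exact (mul_mul_mul_comm _ _ _ _).le

theorem wnorm_C (r : ℝ≥0) (c : ℂ) : wnorm r (C c) = ‖c‖₊ := by
  classical
  rw [wnorm, tsum_eq_single 0]
  · simp
  · intro d hd
    rw [coeff_C, if_neg hd]
    simp

theorem wnorm_mono {r s : ℝ≥0} (h : r ≤ s) (g : Series) : wnorm r g ≤ wnorm s g :=
  ENNReal.tsum_le_tsum fun d => by gcongr

/-- Without a constant term, every monomial gains at least one factor `s`; hence the norm can be
made arbitrarily small. -/
theorem wnorm_mul_radius_le {s : ℝ≥0} (hs : s ≤ 1) (r : ℝ≥0) {g : Series} (hg : g ∈ filt 1) :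
    wnorm (s * r) g ≤ s * wnorm r g := by
  rw [wnorm, wnorm, ← ENNReal.tsum_mul_left]
  refine ENNReal.tsum_le_tsum fun d => ?_
  rw [← ENNReal.coe_mul, ENNReal.coe_le_coe]
  by_cases hd : d.degree < 1
  · rw [hg d hd]
    simp
  · rw [mul_pow, mul_left_comm]
    gcongr
    exact pow_le_of_le_one zero_le hs (by omega)

theorem exists_wnorm_le {g : Series} (hg : g ∈ filt 1) (hc : IsConvergent g) {ε : ℝ≥0}
    (hε : 0 < ε) : ∃ r : ℝ≥0, 0 < r ∧ wnorm r g ≤ ε := by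
  obtain ⟨r, hr, h⟩ := isConvergent_iff_wnorm.1 hc
  lift wnorm r g to ℝ≥0 using h with M hM
  refine ⟨min 1 (ε / (M + 1)) * r, by positivity, ?_⟩
  refine (wnorm_mul_radius_le (min_le_left _ _) r hg).trans ?_
  rw [← hM, ← ENNReal.coe_mul, ENNReal.coe_le_coe]
  calc min 1 (ε / (M + 1)) * M ≤ ε / (M + 1) * (M + 1) := by
        gcongr
        · exact min_le_right _ _
        · exact le_self_add
    _ = ε := div_mul_cancel₀ _ (by positivity)

namespace IsConvergent

theorem add {g h : Series} (hg : IsConvergent g) (hh : IsConvergent h) : IsConvergent (g + h) := by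
  obtain ⟨r, hr, hg⟩ := isConvergent_iff_wnorm.1 hg
  obtain ⟨s, hs, hh⟩ := isConvergent_iff_wnorm.1 hh
  refine isConvergent_iff_wnorm.2 ⟨min r s, lt_min hr hs, ne_top_of_le_ne_top
    (ENNReal.add_ne_top.2 ⟨hg, hh⟩) ((wnorm_add_le _ _ _).trans ?_)⟩
  exact add_le_add (wnorm_mono (min_le_left _ _) _) (wnorm_mono (min_le_right _ _) _)

theorem mul {g h : Series} (hg : IsConvergent g) (hh : IsConvergent h) : IsConvergent (g * h) := by
  obtain ⟨r, hr, hg⟩ := isConvergent_iff_wnorm.1 hg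
  obtain ⟨s, hs, hh⟩ := isConvergent_iff_wnorm.1 hh
  refine isConvergent_iff_wnorm.2 ⟨min r s, lt_min hr hs, ne_top_of_le_ne_top
    (ENNReal.mul_ne_top hg hh) ((wnorm_mul_le _ _ _).trans ?_)⟩
  exact mul_le_mul' (wnorm_mono (min_le_left _ _) _) (wnorm_mono (min_le_right _ _) _)

theorem const (c : ℂ) : IsConvergent (C c : Series) :=
  isConvergent_iff_wnorm.2 ⟨1, one_pos, by rw [wnorm_C]; exact ENNReal.coe_ne_top⟩

theorem monomial (d : Fin 2 →₀ ℕ) (c : ℂ) : IsConvergent (MvPowerSeries.monomial d c : Series) := by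
  classical
  refine ⟨1, one_pos, summable_of_ne_finset_zero (s := {d}) fun e he => ?_⟩
  rw [coeff_monomial, if_neg (by simpa using he)]
  simp

theorem X (i : Fin 2) : IsConvergent (MvPowerSeries.X i : Series) := monomial _ _

theorem neg {g : Series} (hg : IsConvergent g) : IsConvergent (-g) := by
  simpa using (const (-1)).mul hg

theorem sub {g h : Series} (hg : IsConvergent g) (hh : IsConvergent h) : IsConvergent (g - h) := by
  simpa [sub_eq_add_neg] using hg.add hh.neg

theorem pow {g : Series} (hg : IsConvergent g) (n : ℕ) : IsConvergent (g ^ n) := by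
  induction n with
  | zero => simpa using const 1
  | succ n ih => rw [pow_succ]; exact ih.mul hg

theorem exists_bound {σ : Type} {g : MvPowerSeries σ ℂ} (hg : IsConvergent g) :
    ∃ C R : ℝ, 0 ≤ C ∧ 1 ≤ R ∧ ∀ d, ‖coeff d g‖ ≤ C * R ^ d.degree := by
  obtain ⟨r, hr, h⟩ := hg
  refine ⟨∑' d : σ →₀ ℕ, ‖coeff d g‖ * r ^ d.degree, max 1 r⁻¹,
    tsum_nonneg fun d => by positivity, le_max_left _ _, fun d => ?_⟩
  have h1 : ‖coeff d g‖ * r ^ d.degree ≤ ∑' d : σ →₀ ℕ, ‖coeff d g‖ * r ^ d.degree :=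
    h.le_tsum d fun e _ => by positivity
  calc ‖coeff d g‖ = ‖coeff d g‖ * r ^ d.degree * (r⁻¹) ^ d.degree := by
        rw [mul_assoc, ← mul_pow, mul_inv_cancel₀ hr.ne', one_pow, mul_one]
    _ ≤ _ := by
        gcongr
        exact le_max_right _ _

end IsConvergent

theorem summable_pow_degree : Summable fun d : Fin 2 →₀ ℕ => (1 / 2 : ℝ) ^ d.degree := by
  have h := summable_geometric_two.mul_of_nonneg summable_geometric_two
    (fun n => by positivity) (fun n => by positivity)
  have hinj : Function.Injective fun d : Fin 2 →₀ ℕ => (d 0, d 1) := by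
    intro d e hde
    rw [← bidegree_self d, bidegree_eq_iff]
    simpa [Prod.ext_iff] using hde
  refine (h.comp_injective hinj).congr fun d => ?_
  rw [Finsupp.degree_eq_sum, Fin.sum_univ_two, pow_add]
  rfl

theorem isConvergent_of_bound {g : Series} {C R : ℝ} (hR : 1 ≤ R)
    (h : ∀ d, ‖coeff d g‖ ≤ C * R ^ d.degree) : IsConvergent g := by
  have hR0 : 0 < R := zero_lt_one.trans_le hR
  refine ⟨1 / 2 * R⁻¹, by positivity, Summable.of_nonneg_of_le (fun d => by positivity)
    (fun d => ?_) (summable_pow_degree.mul_left C)⟩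
  calc ‖coeff d g‖ * (1 / 2 * R⁻¹) ^ d.degree
      ≤ C * R ^ d.degree * (1 / 2 * R⁻¹) ^ d.degree := by gcongr; exact h d
    _ = C * (1 / 2) ^ d.degree := by
      rw [mul_assoc, ← mul_pow, mul_left_comm, mul_inv_cancel₀ hR0.ne', mul_one]

theorem IsConvergent.pderiv {g : Series} (hg : IsConvergent g) (i : Fin 2) :
    IsConvergent (MvPowerSeries.pderiv ℂ i g) := by
  obtain ⟨C, R, hC, hR, h⟩ := hg.exists_bound
  have hR0 : 0 < R := zero_lt_one.trans_le hR
  refine isConvergent_of_bound (C := C * R) (R := R * 2) (by linarith) fun d => ?_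
  have h1 : ((d i : ℝ) + 1) ≤ 2 ^ d.degree := by
    have : d i + 1 ≤ 2 ^ d.degree :=
      (Nat.succ_le_succ (Finsupp.le_degree i d)).trans (Nat.lt_two_pow_self)
    exact_mod_cast this
  rw [coeff_pderiv, norm_mul]
  have h2 : ‖((d i : ℕ) : ℂ) + 1‖ = (d i : ℝ) + 1 := by
    rw [← Nat.cast_add_one, Complex.norm_natCast, Nat.cast_add_one]
  rw [h2]
  calc _ ≤ C * R ^ (d.degree + 1) * 2 ^ d.degree := by
        refine mul_le_mul ?_ h1 (by positivity) (by positivity)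
        have := h (d + Finsupp.single i 1)
        rwa [map_add Finsupp.degree, Finsupp.degree_single] at this
    _ = _ := by rw [pow_succ, mul_pow]; ring

/-- The truncation of `g` to the terms of degree less than `n`. -/
def truncDegree (n : ℕ) (g : Series) : Series := fun d => if d.degree < n then coeff d g else 0

theorem coeff_truncDegree (n : ℕ) (g : Series) (d : Fin 2 →₀ ℕ) :
    coeff d (truncDegree n g) = if d.degree < n then coeff d g else 0 := rfl

theorem sub_truncDegree_mem_filt (n : ℕ) (g : Series) : g - truncDegree n g ∈ filt n := by
  intro d hd
  rw [map_sub, coeff_truncDegree, if_pos hd, sub_self]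

theorem truncDegree_mem_filt {n k : ℕ} {g : Series} (hg : g ∈ filt k) :
    truncDegree n g ∈ filt k := by
  intro d hd
  rw [coeff_truncDegree, hg d hd, ite_self]

theorem wnorm_truncDegree_le_of_sub_mem (r : ℝ≥0) {n : ℕ} {g h : Series} (H : g - h ∈ filt n) :
    wnorm r (truncDegree n g) ≤ wnorm r h := by
  refine ENNReal.tsum_le_tsum fun d => ?_
  rw [coeff_truncDegree]
  split_ifs with hd
  · have := H d hd
    rw [map_sub, sub_eq_zero] at this
    rw [this]
  · simp

theorem wnorm_le_of_truncDegree {r : ℝ≥0} {g : Series} {M : ℝ≥0∞}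
    (h : ∀ n, wnorm r (truncDegree n g) ≤ M) : wnorm r g ≤ M := by
  rw [wnorm, ENNReal.tsum_eq_iSup_sum]
  refine iSup_le fun s => ?_
  refine le_trans ?_ (h (s.sup Finsupp.degree + 1))
  refine le_trans (Finset.sum_le_sum fun d hd => ?_) (ENNReal.sum_le_tsum s)
  rw [coeff_truncDegree, if_pos (Nat.lt_succ_of_le (Finset.le_sup hd))]

/-- A formal inverse square root of a convergent series is convergent. -/
theorem isConvergent_of_sq_mul_eq_one {u g : Series} (hg : IsConvergent g)
    (hu : constantCoeff u = 1) (h : u ^ 2 * g = 1) : IsConvergent u := by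
  have hgc : constantCoeff g = 1 := by
    have := congrArg constantCoeff h
    simpa [hu] using this
  set k : Series := 1 - g with hk
  set v : Series := u - 1 with hv
  have hkm : k ∈ filt 1 := mem_filt_one.2 (by simp [hk, hgc])
  have hvm : v ∈ filt 1 := mem_filt_one.2 (by simp [hv, hu])
  have hkc : IsConvergent k := by
    have := (IsConvergent.const 1).sub hg
    simpa [hk] using this
  obtain ⟨r, hr, hkr⟩ := exists_wnorm_le hkm hkc (ε := 1 / 4) (by norm_num)
  -- With `u = 1 + v` and `g = 1 - k`, the equation `u² g = 1` reads `v = k (1 + v)² / 2 - v² / 2`.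
  let T : Series → Series := fun w => C (1 / 2) * (k * ((C 1 + w) * (C 1 + w))) +
    C (-1 / 2) * (w * w)
  have hC : (C (1 / 2) : Series) * 2 = 1 := by
    rw [← map_ofNat (C : ℂ →+* Series) 2, ← map_mul]
    norm_num
  have hC' : (C (-1 / 2) : Series) = -C (1 / 2) := by
    rw [← map_neg]
    norm_num
  have hTv : T v = v := by
    simp only [T, hC', map_one]
    rw [hk, hv]
    linear_combination (-C (1 / 2)) * h + (u - 1) * hC
  have hTc : ∀ n, v - T (truncDegree n v) ∈ filt (n + 1) := by
    intro n
    have h1 := sub_truncDegree_mem_filt n v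
    have h2 := truncDegree_mem_filt (n := n) hvm
    have e : v - T (truncDegree n v) = C (1 / 2) * ((v - truncDegree n v)
        * (k * (2 + v + truncDegree n v) - (v + truncDegree n v))) := by
      nth_rw 1 [← hTv]
      simp only [T, hC', map_one]
      ring
    rw [e]
    exact Ideal.mul_mem_left _ _ (mul_mem_filt h1 ((filt 1).sub_mem
      ((filt 1).mul_mem_right _ hkm) ((filt 1).add_mem hvm h2)))
  -- The radius makes the norm of `k` at most `1/4`, so the bound is `(1/2)(1/4)(2·2) + 1/2 = 1`.
  -- Stability of the unit ball suffices: the truncations of `v` are reached by formal iteration.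
  have hTb : ∀ w, wnorm r w ≤ 1 → wnorm r (T w) ≤ 1 := by
    intro w hw
    have h1 : wnorm r (C 1 + w) ≤ 2 := by
      refine (wnorm_add_le _ _ _).trans ?_
      rw [wnorm_C, ← one_add_one_eq_two]
      simpa using hw
    have h2 : wnorm r (k * ((C 1 + w) * (C 1 + w))) ≤ ((1 / 4 : ℝ≥0) : ℝ≥0∞) * (2 * 2) :=
      (wnorm_mul_le _ _ _).trans
        (mul_le_mul' hkr ((wnorm_mul_le _ _ _).trans (mul_le_mul' h1 h1)))
    have h3 : wnorm r (w * w) ≤ 1 * 1 := (wnorm_mul_le _ _ _).trans (mul_le_mul' hw hw)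
    calc wnorm r (T w) ≤ wnorm r (C (1 / 2)) * (((1 / 4 : ℝ≥0) : ℝ≥0∞) * (2 * 2))
          + wnorm r (C (-1 / 2)) * (1 * 1) := (wnorm_add_le _ _ _).trans
            (add_le_add ((wnorm_mul_le _ _ _).trans (mul_le_mul' le_rfl h2))
              ((wnorm_mul_le _ _ _).trans (mul_le_mul' le_rfl h3)))
      _ = ((1 / 2 * (1 / 4 * (2 * 2)) + 1 / 2 * (1 * 1) : ℝ≥0) : ℝ≥0∞) := by
          rw [wnorm_C, wnorm_C]
          simp
      _ = 1 := by norm_num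
  have hbound : ∀ n, wnorm r (truncDegree n v) ≤ 1 := by
    intro n
    induction n with
    | zero => simp [wnorm, coeff_truncDegree]
    | succ n ih => exact (wnorm_truncDegree_le_of_sub_mem r (hTc n)).trans (hTb _ ih)
  have hvc : IsConvergent v := isConvergent_iff_wnorm.2
    ⟨r, hr, ne_top_of_le_ne_top ENNReal.one_ne_top (wnorm_le_of_truncDegree hbound)⟩
  have := hvc.add (IsConvergent.const 1)
  simpa [hv] using this

/-! ### Uniform bounds by Baire's theorem -/

/-- The Banach space of absolutely summable families of coefficients. -/
abbrev SummableCoeffs := lp (fun _ : Fin 2 →₀ ℕ => ℂ) 1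

/-- The power series with a summable family of coefficients. -/
def toSeries (e : SummableCoeffs) : Series := fun d => e d

theorem coeff_toSeries (e : SummableCoeffs) (d : Fin 2 →₀ ℕ) : coeff d (toSeries e) = e d := rfl

theorem isConvergent_toSeries (e : SummableCoeffs) : IsConvergent (toSeries e) := by
  refine ⟨1, one_pos, ?_⟩
  have := (memℓp_gen_iff (p := 1) (by simp)).1 (lp.memℓp e)
  simpa [coeff_toSeries] using this

theorem continuous_coeff_toSeries (d : Fin 2 →₀ ℕ) :
    Continuous fun e : SummableCoeffs => coeff d (toSeries e) := by
  refine (LipschitzWith.of_dist_le_mul (K := 1) fun e e' => ?_).continuous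
  rw [dist_eq_norm, dist_eq_norm, NNReal.coe_one, one_mul]
  exact lp.norm_apply_le_norm one_ne_zero (e - e') d

/-- Functionals that are exponentially bounded on each convergent series are uniformly
exponentially bounded on monomials. -/
theorem exists_uniform_bound (L : ℕ → Series →ₗ[ℂ] ℂ)
    (hcont : ∀ n, Continuous fun e : SummableCoeffs => L n (toSeries e))
    (h : ∀ Δ, IsConvergent Δ → ∃ K : ℕ, ∀ n, ‖L n Δ‖ ≤ (K : ℝ) ^ (n + 1)) :
    ∃ (A : ℝ) (K : ℕ), ∀ n d, ‖L n (monomial d 1)‖ ≤ A * (K : ℝ) ^ (n + 1) := by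
  -- Closed sets indexed by an integer `K`, so that the cover is countable and one of them contains
  -- a ball.
  let S : ℕ → Set SummableCoeffs := fun K => {e | ∀ n, ‖L n (toSeries e)‖ ≤ (K : ℝ) ^ (n + 1)}
  have hclosed : ∀ K, IsClosed (S K) := by
    intro K
    have : S K = ⋂ n, {e | ‖L n (toSeries e)‖ ≤ (K : ℝ) ^ (n + 1)} := by
      ext e
      simp [S]
    rw [this]
    exact isClosed_iInter fun n => isClosed_le (hcont n).norm continuous_const
  have hunion : ⋃ K, S K = Set.univ := by
    refine Set.eq_univ_of_forall fun e => ?_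
    obtain ⟨K, hK⟩ := h _ (isConvergent_toSeries e)
    exact Set.mem_iUnion.2 ⟨K, hK⟩
  obtain ⟨K, e₀, he₀⟩ := nonempty_interior_of_iUnion_of_closed hclosed hunion
  rw [mem_interior_iff_mem_nhds, Metric.mem_nhds_iff] at he₀
  obtain ⟨ε, hε, hball⟩ := he₀
  refine ⟨4 / ε, K, fun n d => ?_⟩
  -- Every monomial has `ℓ¹` norm one, so half the radius works for all `d`. Subtracting the values
  -- at `e₀ + s` and `e₀` gives `2 K^(n+1)`, and dividing by `ε / 2` gives the constant `4 / ε`.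
  let s : SummableCoeffs := lp.single 1 d (((ε / 2 : ℝ)) : ℂ)
  have hs : ‖s‖ < ε := by
    have : ‖s‖ = ‖(((ε / 2 : ℝ)) : ℂ)‖ := lp.norm_single one_pos _ _
    rw [this, Complex.norm_real, Real.norm_eq_abs, abs_of_pos (by positivity)]
    linarith
  have h0 := hball (Metric.mem_ball_self hε) n
  have h1 : e₀ + s ∈ S K := hball (by simpa [mem_ball_iff_norm] using hs)
  have h1 := h1 n
  have e : toSeries (e₀ + s) = toSeries e₀ + ((ε / 2 : ℝ) : ℂ) • monomial d 1 := by
    classical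
    ext d'
    rw [map_add, coeff_toSeries, coeff_toSeries, coeff_smul, coeff_monomial]
    change e₀ d' + s d' = _
    congr 1
    rw [lp.single_apply, Pi.single_apply]
    split_ifs <;> simp
  rw [e, map_add, map_smul] at h1
  have h2 : ‖((ε / 2 : ℝ) : ℂ) • L n (monomial d 1)‖ ≤ (K : ℝ) ^ (n + 1) + (K : ℝ) ^ (n + 1) := by
    have := norm_sub_le (L n (toSeries e₀) + ((ε / 2 : ℝ) : ℂ) • L n (monomial d 1))
      (L n (toSeries e₀))
    rw [add_sub_cancel_left] at this
    exact this.trans (add_le_add h1 h0)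
  rw [norm_smul, Complex.norm_real, Real.norm_eq_abs, abs_of_pos (by positivity)] at h2
  rw [div_mul_eq_mul_div, le_div_iff₀ hε]
  linarith

/-! ### Recovering a polynomial from its moments -/

/-- The product of the distances from `s` to the other integers in `[0, m]`. -/
theorem prod_erase_norm_sub {m s : ℕ} (hs : s ≤ m) :
    ∏ t ∈ (Finset.range (m + 1)).erase s, ‖(s : ℂ) - t‖ = (s.factorial * (m - s).factorial : ℕ) := by
  induction m, hs using Nat.le_induction with
  | base =>
    rw [Finset.range_add_one, Finset.erase_insert (by simp), Nat.sub_self, Nat.factorial_zero,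
      mul_one, ← Finset.prod_range_add_one_eq_factorial, ← Finset.prod_range_reflect,
      Nat.cast_prod]
    refine Finset.prod_congr rfl fun t ht => ?_
    rw [Finset.mem_range] at ht
    rw [← Nat.cast_sub (by omega), Complex.norm_natCast]
    congr 1
    omega
  | succ m hm ih =>
    rw [Finset.range_add_one, Finset.erase_insert_of_ne (by omega), Finset.prod_insert (by simp),
      ih, Nat.succ_sub hm, Nat.factorial_succ, norm_sub_rev, ← Nat.cast_sub (by omega),
      Complex.norm_natCast, Nat.succ_sub hm]
    push_cast
    ring

theorem prod_range_norm_add (m s : ℕ) : ∏ j ∈ Finset.range (m + 1), ‖(s : ℂ) + j + 1‖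
    = ((m + 1).factorial * (s + (m + 1)).choose (m + 1) : ℕ) := by
  rw [← Nat.ascFactorial_eq_factorial_mul_choose, Nat.ascFactorial_eq_prod_range, Nat.cast_prod]
  refine Finset.prod_congr rfl fun j _ => ?_
  rw [← Complex.norm_natCast]
  push_cast
  ring_nf

/-- The coefficients of a polynomial in terms of its moments. -/
theorem coeff_eq_sum_moments (m : ℕ) (p : ℕ → ℂ) {i : ℕ} (hi : i ≤ m) :
    p i * ∏ j ∈ (Finset.range (m + 1)).erase i, ((j : ℂ) - i) =
      ∑ s ∈ Finset.range (m + 1),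
        ((∑ l ∈ Finset.range (m + 1), p l / ((s : ℂ) + l + 1))
          * ∏ j ∈ Finset.range (m + 1), ((s : ℂ) + j + 1))
        * ∏ t ∈ (Finset.range (m + 1)).erase s, (((s : ℂ) - t)⁻¹ * (-(i : ℂ) - 1 - t)) := by
  classical
  -- `P(z)` is `∑ p_l / (z + l + 1)` with denominators cleared. Its values at `0, …, m` are the
  -- moments times known products, while at `-i - 1` only the term `l = i` survives. As its degree
  -- is at most `m`, Lagrange interpolation links the two.
  let P : Polynomial ℂ := ∑ l ∈ Finset.range (m + 1), Polynomial.C (p l) *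
    ∏ j ∈ (Finset.range (m + 1)).erase l, (Polynomial.X + Polynomial.C ((j : ℂ) + 1))
  have heval : ∀ z, P.eval z = ∑ l ∈ Finset.range (m + 1), p l *
      ∏ j ∈ (Finset.range (m + 1)).erase l, (z + ((j : ℂ) + 1)) := by
    intro z
    simp [P, Polynomial.eval_finsetSum, Polynomial.eval_prod]
  have hdeg : P.degree < (Finset.range (m + 1)).card := by
    rw [Finset.card_range]
    refine (Polynomial.degree_sum_le _ _).trans_lt ?_
    rw [Finset.sup_lt_iff (by exact WithBot.bot_lt_coe _)]
    intro l hl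
    refine (Polynomial.degree_mul_le _ _).trans_lt ?_
    refine (add_le_add Polynomial.degree_C_le le_rfl).trans_lt ?_
    rw [zero_add]
    rw [Polynomial.degree_prod]
    simp only [Polynomial.degree_X_add_C, Finset.sum_const, Finset.card_erase_of_mem hl,
      Finset.card_range, Nat.add_sub_cancel]
    rw [nsmul_one]
    exact_mod_cast Nat.lt_succ_self m
  have hinj : Set.InjOn (fun t : ℕ => (t : ℂ)) (Finset.range (m + 1)) :=
    Nat.cast_injective.injOn
  have hP := congrArg (Polynomial.eval (-(i : ℂ) - 1)) (Lagrange.eq_interpolate hinj hdeg)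
  rw [heval, Lagrange.interpolate_apply, Polynomial.eval_finsetSum] at hP
  rw [Finset.sum_eq_single i] at hP
  · have hl : ∏ j ∈ (Finset.range (m + 1)).erase i, (-(i : ℂ) - 1 + ((j : ℂ) + 1))
        = ∏ j ∈ (Finset.range (m + 1)).erase i, ((j : ℂ) - i) :=
      Finset.prod_congr rfl fun j _ => by ring
    rw [hl] at hP
    rw [hP]
    refine Finset.sum_congr rfl fun s hs => ?_
    rw [Polynomial.eval_mul, Polynomial.eval_C, heval, Lagrange.basis, Polynomial.eval_prod]
    congr 1
    · rw [Finset.sum_mul]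
      refine Finset.sum_congr rfl fun l hl => ?_
      have hne : (s : ℂ) + l + 1 ≠ 0 := by exact_mod_cast Nat.succ_ne_zero (s + l)
      rw [← Finset.mul_prod_erase _ _ hl, ← mul_assoc, div_mul_cancel₀ _ hne]
      simp only [add_assoc]
    · refine Finset.prod_congr rfl fun t _ => ?_
      simp [Lagrange.basisDivisor]
  · intro l hl hli
    rw [Finset.prod_eq_zero (i := i), mul_zero]
    · exact Finset.mem_erase.2 ⟨hli.symm, by rw [Finset.mem_range]; omega⟩
    · ring
  · intro h
    exact absurd (Finset.mem_range.2 (Nat.lt_succ_of_le hi)) h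

/-- A polynomial of degree at most `m` is bounded exponentially in `m` by its first moments. -/
theorem norm_coeff_le_of_moments (m : ℕ) (p : ℕ → ℂ) {M : ℝ}
    (hM : ∀ s ≤ m, ‖∑ l ∈ Finset.range (m + 1), p l / ((s : ℂ) + l + 1)‖ ≤ M) {i : ℕ}
    (hi : i ≤ m) : ‖p i‖ ≤ 4 * M * 512 ^ m := by
  have hM0 : 0 ≤ M := (norm_nonneg _).trans (hM 0 (Nat.zero_le _))
  -- The factorials combine into `(m + 1)` times two binomial coefficients, each exponentially
  -- bounded. The estimate serves twice: at the node `s`, and for the evaluation at `-i - 1` divided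
  -- by `i! (m - i)!`.
  have key : ∀ s ≤ m, ((s.factorial * (m - s).factorial : ℕ) : ℝ)⁻¹
      * (((m + 1).factorial * (s + (m + 1)).choose (m + 1) : ℕ) : ℝ)
      ≤ (m + 1) * (2 * 8 ^ m) := by
    intro s hs
    rw [inv_mul_le_iff₀ (by positivity)]
    have h1 : (s + (m + 1)).choose (m + 1) ≤ 2 * 4 ^ m := by
      refine (Nat.choose_le_two_pow _ _).trans ?_
      calc 2 ^ (s + (m + 1)) ≤ 2 ^ (m + (m + 1)) := Nat.pow_le_pow_right (by norm_num) (by omega)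
        _ = 2 * 4 ^ m := by
          rw [show (4 : ℕ) = 2 * 2 by norm_num, mul_pow]
          ring
    have h2 : m.factorial ≤ 2 ^ m * (s.factorial * (m - s).factorial) := by
      rw [← Nat.choose_mul_factorial_mul_factorial hs, mul_assoc]
      exact Nat.mul_le_mul_right _ (Nat.choose_le_two_pow _ _)
    have h3 : (m + 1).factorial * (s + (m + 1)).choose (m + 1)
        ≤ (s.factorial * (m - s).factorial) * ((m + 1) * (2 * 8 ^ m)) := by
      rw [Nat.factorial_succ]
      calc (m + 1) * m.factorial * (s + (m + 1)).choose (m + 1)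
          ≤ (m + 1) * (2 ^ m * (s.factorial * (m - s).factorial)) * (2 * 4 ^ m) := by gcongr
        _ = (s.factorial * (m - s).factorial) * ((m + 1) * (2 * (2 * 4) ^ m)) := by
          rw [mul_pow]
          ring
        _ = _ := by norm_num
    exact_mod_cast h3
  have hprod := congrArg norm (coeff_eq_sum_moments m p hi)
  rw [norm_mul, norm_prod] at hprod
  simp only [norm_sub_rev _ (i : ℂ)] at hprod
  rw [prod_erase_norm_sub hi] at hprod
  have hpos : (0 : ℝ) < (i.factorial * (m - i).factorial : ℕ) := by positivity
  have hsum : ‖p i‖ * (i.factorial * (m - i).factorial : ℕ)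
      ≤ ∑ s ∈ Finset.range (m + 1), M * ((m + 1) * (2 * 8 ^ m))
        * (((m + 1).factorial * (i + (m + 1)).choose (m + 1) : ℕ) : ℝ) := by
    rw [hprod]
    refine (norm_sum_le _ _).trans (Finset.sum_le_sum fun s hs => ?_)
    have hsm : s ≤ m := Nat.lt_succ_iff.1 (Finset.mem_range.1 hs)
    rw [norm_mul, norm_mul, norm_prod, norm_prod, prod_range_norm_add]
    simp only [norm_mul, norm_inv]
    rw [Finset.prod_mul_distrib, Finset.prod_inv_distrib, prod_erase_norm_sub hsm]
    have h1 : ∏ t ∈ (Finset.range (m + 1)).erase s, ‖-(i : ℂ) - 1 - t‖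
        ≤ (((m + 1).factorial * (i + (m + 1)).choose (m + 1) : ℕ) : ℝ) := by
      rw [← prod_range_norm_add]
      have e : ∀ t : ℕ, ‖-(i : ℂ) - 1 - t‖ = ‖(i : ℂ) + t + 1‖ := fun t => by
        rw [← norm_neg]
        congr 1
        ring
      simp only [e]
      refine Finset.prod_le_prod_of_subset_of_one_le (Finset.erase_subset _ _)
        (fun t _ => norm_nonneg _) fun t _ _ => ?_
      have : ‖(i : ℂ) + t + 1‖ = ((i + t + 1 : ℕ) : ℝ) := by
        rw [← Complex.norm_natCast]
        push_cast
        rfl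
      rw [this]
      exact_mod_cast Nat.succ_pos _
    calc _ = ‖∑ l ∈ Finset.range (m + 1), p l / ((s : ℂ) + l + 1)‖
          * (((s.factorial * (m - s).factorial : ℕ) : ℝ)⁻¹
            * (((m + 1).factorial * (s + (m + 1)).choose (m + 1) : ℕ) : ℝ))
          * ∏ t ∈ (Finset.range (m + 1)).erase s, ‖-(i : ℂ) - 1 - t‖ := by ring
      _ ≤ _ := by
        exact mul_le_mul (mul_le_mul (hM s hsm) (key s hsm) (by positivity) hM0) h1
          (Finset.prod_nonneg fun t _ => norm_nonneg _) (by positivity)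
  rw [Finset.sum_const, Finset.card_range, nsmul_eq_mul, ← le_div_iff₀ hpos] at hsum
  refine hsum.trans ?_
  have hm2 : ((m : ℝ) + 1) ≤ 2 ^ m := by exact_mod_cast Nat.lt_two_pow_self (n := m)
  calc _ = ((m : ℝ) + 1) * M * ((m + 1) * (2 * 8 ^ m)) *
        (((i.factorial * (m - i).factorial : ℕ) : ℝ)⁻¹
        * (((m + 1).factorial * (i + (m + 1)).choose (m + 1) : ℕ) : ℝ)) := by
        push_cast
        ring
    _ ≤ 2 ^ m * M * (2 ^ m * (2 * 8 ^ m)) * (2 ^ m * (2 * 8 ^ m)) := by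
        refine mul_le_mul (by gcongr) ((key i hi).trans (by gcongr)) (by positivity)
          (by positivity)
    _ = 4 * M * (2 * 2 * 8 * 2 * 8) ^ m := by
        simp only [mul_pow]
        ring
    _ = _ := by norm_num

/-! ### Convergence of the weight and of the logarithm -/

/-- The coefficient of `y^(n + 1)` in `∫_0^y w Δ dx`, as a functional of `Δ`. -/
def momentFunctional (w : Series) (n : ℕ) : Series →ₗ[ℂ] ℂ :=
  ∑ p ∈ Finset.HasAntidiagonal.antidiagonal n,
    ((p.1 : ℂ) + 1)⁻¹ • (coeff (bidegree p.1 p.2)).comp (LinearMap.mulLeft ℂ w)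

theorem momentFunctional_apply (w : Series) (n : ℕ) (Δ : Series) : momentFunctional w n Δ
    = ∑ p ∈ Finset.HasAntidiagonal.antidiagonal n,
      coeff (bidegree p.1 p.2) (w * Δ) / ((p.1 : ℂ) + 1) := by
  simp [momentFunctional, LinearMap.sum_apply, div_eq_inv_mul]

theorem continuous_momentFunctional (w : Series) (n : ℕ) :
    Continuous fun e : SummableCoeffs => momentFunctional w n (toSeries e) := by
  simp only [momentFunctional_apply, coeff_mul]
  exact continuous_finsetSum _ fun p _ => (continuous_finsetSum _ fun q _ =>
    (continuous_coeff_toSeries q.2).const_mul _).div_const _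

/-- Multiplication by `x^k` shifts degrees, so in degree `k + m` only the part of `w` of degree `m`
is seen, through its `k`-th moment on `[0, 1]`. -/
theorem momentFunctional_monomial (w : Series) (m k : ℕ) :
    momentFunctional w (k + m) (monomial (bidegree k 0) 1)
      = ∑ l ∈ Finset.range (m + 1), coeff (bidegree l (m - l)) w / ((k : ℂ) + l + 1) := by
  have hle : ∀ i j, bidegree k 0 ≤ bidegree i j ↔ k ≤ i := by
    intro i j
    constructor
    · intro h
      simpa using h 0
    · intro h s
      fin_cases s
      · simpa using h
      · simp
  rw [momentFunctional_apply, Finset.Nat.sum_antidiagonal_eq_sum_range_succ_mk, Nat.succ_eq_add_one,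
    add_assoc, Finset.sum_range_add, Finset.sum_eq_zero, zero_add]
  · refine Finset.sum_congr rfl fun l hl => ?_
    have hsub : bidegree (k + l) (k + m - (k + l)) - bidegree k 0 = bidegree l (m - l) := by
      rw [eq_comm, bidegree_eq_iff, Finsupp.tsub_apply, Finsupp.tsub_apply]
      simp
      omega
    dsimp only
    rw [coeff_mul_monomial, if_pos ((hle _ _).2 (Nat.le_add_right k l)), mul_one, hsub]
    push_cast
    rfl
  · intro i hi
    rw [Finset.mem_range] at hi
    dsimp only
    rw [coeff_mul_monomial, if_neg (by rw [hle]; omega), zero_div]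

/-- If `∫_0^y w Δ dx` converges for every convergent `Δ`, then `w` converges. -/
theorem isConvergent_of_momentFunctional {w : Series}
    (h : ∀ Δ, IsConvergent Δ → ∃ K : ℕ, ∀ n, ‖momentFunctional w n Δ‖ ≤ (K : ℝ) ^ (n + 1)) :
    IsConvergent w := by
  obtain ⟨A, K, hAK⟩ := exists_uniform_bound _ (continuous_momentFunctional w) h
  set B : ℝ := max A 0
  set R : ℝ := (K : ℝ) + 1
  have hR : 1 ≤ R := by simp [R]
  have hR2 : 1 ≤ R ^ 2 := one_le_pow₀ hR
  refine isConvergent_of_bound (C := 4 * (B * R)) (R := R ^ 2 * 512) (by linarith) fun d => ?_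
  have hd : d.degree = d 0 + d 1 := by rw [Finsupp.degree_eq_sum, Fin.sum_univ_two]
  -- Moments of order `s ≤ m = d.degree` suffice, so the functionals have index `s + m ≤ 2m` and the
  -- bound stays exponential in `m`.
  have hbound := norm_coeff_le_of_moments d.degree
    (fun l => coeff (bidegree l (d.degree - l)) w) (M := B * R ^ (2 * d.degree + 1))
    (fun s hs => by
      rw [← momentFunctional_monomial]
      refine (hAK _ _).trans (mul_le_mul (le_max_left _ _) ?_ (by positivity) (le_max_right _ _))
      calc (K : ℝ) ^ (s + d.degree + 1) ≤ R ^ (s + d.degree + 1) := by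
            gcongr
            simp [R]
        _ ≤ R ^ (2 * d.degree + 1) := pow_le_pow_right₀ hR (by omega)) (i := d 0) (by omega)
  have hd1 : bidegree (d 0) (d.degree - d 0) = d := by
    rw [bidegree_eq_iff]
    omega
  rw [hd1] at hbound
  refine hbound.trans_eq ?_
  rw [mul_pow, pow_succ, pow_mul]
  ring

theorem isConvergent_twoCurves (a b : ℕ) : IsConvergent (twoCurves a b) :=
  ((IsConvergent.X 0).pow a).mul (((IsConvergent.X 0).sub (IsConvergent.X 1)).pow b)

theorem fieldLog_converges {a b : ℕ} (ha : 0 < a) (hb : 0 < b) {φ₀ : FormalMap}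
    (hφ₀ : φ₀ ∈ DPrime (twoCurves a b))
    (h : ∀ Δ : Series, IsConvergent Δ → IsConvergent (σ := Unit) (reducedOperator a b φ₀ Δ)) :
    (fieldLog φ₀).Converges := by
  obtain ⟨hlog, hu1, hu⟩ :=
    fieldLog_eq_of_mem_DPrime (twoCurves_mem_filt ha hb) (twoCurves_ne_zero a b) hφ₀
  have hw : IsConvergent (weight (twoCurves a b) φ₀) := by
    refine isConvergent_of_momentFunctional fun Δ hΔ => ?_
    obtain ⟨C, R, hC, hR, hCR⟩ := (h Δ hΔ).exists_bound
    -- Replacing `C` by `max 1 C` absorbs the constant into the base, since `C ≤ (max 1 C)^(n+1)`.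
    obtain ⟨K, hK⟩ := exists_nat_ge (max 1 C * R)
    refine ⟨K, fun n => ?_⟩
    have h1 : ‖momentFunctional (weight (twoCurves a b) φ₀) n Δ‖ ≤ C * R ^ (n + 1) := by
      rw [momentFunctional_apply, ← coeff_succ_reducedOperator]
      have := hCR (Finsupp.single () (n + 1))
      rwa [Finsupp.degree_single] at this
    calc _ ≤ C * R ^ (n + 1) := h1
      _ ≤ max 1 C ^ (n + 1) * R ^ (n + 1) := by
        gcongr
        exact (le_max_right 1 C).trans (le_self_pow₀ (le_max_left 1 C) (Nat.succ_ne_zero n))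
      _ ≤ (K : ℝ) ^ (n + 1) := by
        rw [← mul_pow]
        gcongr
  have huc := isConvergent_of_sq_mul_eq_one (hw.mul ((hφ₀.1.1.1 0).pderiv 0)) hu1 hu
  intro i
  rw [hlog]
  fin_cases i
  · exact (isConvergent_twoCurves a b).mul huc
  · simpa [horizontal] using IsConvergent.const 0

end UpDiffeo

end

theorem mainTheorem8 (a b : ℕ) (ha : 0 < a) (hb : 0 < b)
    (φ₀ : UpDiffeo.FormalMap) (hφ₀ : φ₀ ∈ UpDiffeo.DPrime (UpDiffeo.twoCurves a b)) :
    ((∀ Δ : UpDiffeo.Series, UpDiffeo.IsConvergent Δ →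
        UpDiffeo.IsConvergent (σ := Unit) (UpDiffeo.derivedOperator a b φ₀ Δ)) →
      (UpDiffeo.fieldLog φ₀).Converges) ∧
    ((∀ Δ : UpDiffeo.Series, UpDiffeo.IsConvergent Δ →
        UpDiffeo.IsConvergent (σ := Unit) (UpDiffeo.reducedOperator a b φ₀ Δ)) →
      (UpDiffeo.fieldLog φ₀).Converges) := by
  refine ⟨fun h => ?_, UpDiffeo.fieldLog_converges ha hb hφ₀⟩
  refine UpDiffeo.fieldLog_converges ha hb hφ₀ fun Δ hΔ => ?_
  rw [← UpDiffeo.derivedOperator_eq_reducedOperator ha hb hφ₀]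
  exact h Δ hΔ
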